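/- Setup. Let $\mathcal G$ be a connected undirected graph on the agents $\{1,\dots,N\}$ and let $W\in\mathbb R^{N\times N}$ be a valid gossip matrix for it: nonnegative, symmetric, doubly stochastic, $W_{nn}>0$ for all $n$, and for $i\ne j$, $W_{ij}>0$ if $\{i,j\}$ is an edge and $W_{ij}=0$ otherwise. A zero-mean contraction factor of $W$ is a number $\rho\in[0,1)$ with $\|Wz\|_2\le\rho\|z\|_2$ for all $z\in\mathbb R^N$ with $\sum_n z_n=0$. Let $\mathcal H$ be a real Hilbert space. A compressor with mean-square residual $\alpha\in[0,1)$ is a measurable map $\mathcal C:\Omega\times\mathcal H\to\mathcal H$, for a probability space $(\Omega,P)$, with $\mathbb E_{\omega\sim P}\|\mathcal C(\omega,v)-v\|^2\le\alpha\|v\|^2$ for every $v\in\mathcal H$. (If $\mathcal H$ is not separable, measurable means jointly strongly measurable on $\Omega\times K$ for every separable $K\subset\mathcal H$, and random vectors in $\mathcal H$ are strongly measurable.) Potentials. For $\varepsilon>0$ let $$F_t^{\mathrm{KT}}(x)=\varepsilon\,\frac{2^t\,\Gamma\!\left(\frac{t+1}{2}+\frac x2\right)\Gamma\!\left(\frac{t+1}{2}-\frac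 x2\right)}{\pi\,t!},\qquad F_t^{\mathrm{SE}}(x)=\frac{\varepsilon}{\sqrt{t+1}}\exp\!\left(\frac{x^2}{2(t+1)}\right).$$ For $F=F^{\mathsf P}$ with $\mathsf P\in\{\mathrm{KT},\mathrm{SE}\}$ put $\beta_t(x)=\frac{F_t(x+1)-F_t(x-1)}{F_t(x+1)+F_t(x-1)}$, $h_t(x)=\beta_t(x)F_{t-1}(x)$ for $t\ge1$, $\operatorname{Bet}_t(0)=0$, $\operatorname{Bet}_t(G)=\frac{h_t(\|G\|)}{\|G\|}G$ for $G\ne0$, and $F_T^*(\theta)=\sup_{0\le s\le T}\{\theta s-F_T(s)\}$. Let $\operatorname{clip}_t(G)=G$ if $\|G\|\le t$ and $\operatorname{clip}_t(G)=\frac{t}{\|G\|}G$ otherwise. Algorithm (DECO-EF). Start from $G_{n,0}=\widehat G_{n,0}=0$. In round $t=0,1,\dots$ agent $n$ predicts $x_{n,t}=\operatorname{Bet}_{t+1}(\operatorname{clip}_t(G_{n,t}))$, observes a subgradient $g_{n,t}\in\partial\ell_{n,t}(x_{n,t})$ of its local loss, and sets $Z^0_{n,t}=G_{n,t}-g_{n,t}$,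 $\widehat Z^0_{n,t}=\widehat G_{n,t}$. For $k=0,\dots,q(t)-1$ all agents perform $$\widehat Z^{k+1}_{n,t}=\widehat Z^k_{n,t}+\mathcal C(\omega^k_{n,t},v^k_{n,t}),\quad v^k_{n,t}=Z^k_{n,t}-\widehat Z^k_{n,t},\qquad Z^{k+1}_{n,t}=Z^k_{n,t}+\gamma\sum_{j=1}^N W_{nj}\left(\widehat Z^{k+1}_{j,t}-\widehat Z^{k+1}_{n,t}\right),$$ and then $G_{n,t+1}=Z^{q(t)}_{n,t}$, $\widehat G_{n,t+1}=\widehat Z^{q(t)}_{n,t}$. The local losses $\ell_{n,t}:\mathcal H\to\mathbb R$ are convex and $1$-Lipschitz; losses and subgradients may be random (adaptive adversary), measurably. Every draw $\omega^k_{n,t}$ with $k<q(t)$ has law $P$ and is fresh, that is, independent of the current payload vector $(v^k_{1,t},\dots,v^k_{N,t})$; in particular this holds if it is independent of the history before substep $k$ of round $t$. With $\bar\ell_t=\frac1N\sum_{n=1}^N\ell_{n,t}$, the network regret against $u\in\mathcal H$ is $$R_T^{\mathrm{net}}(u)=\sum_{t=0}^{T-1}\frac1N\sum_{n=1}^N\bar\ell_t(x_{n,t})-\sum_{t=0}^{T-1}\bar\ell_t(u).$$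 Theorem (Expected network regret). $W$ has a zero-mean contraction factor. Let $\rho$ be any such factor, and put $\mu=1-\rho$. Suppose $$0<\gamma\le\min\left\{1,\ \frac{1-\sqrt\alpha}{2\sqrt\alpha\,(1+4/\mu)+\mu/2}\right\},\qquad\bar\eta=1-\frac{\gamma\mu}{2},$$ and run DECO-EF with potential $\mathsf P\in\{\mathrm{KT},\mathrm{SE}\}$ and gossip schedule $q(t)=\lceil ct\rceil$, where $c\ge-\frac{2\log2}{\log\bar\eta}$ for $\mathsf P=\mathrm{KT}$ and $c\ge-\frac{3}{2\log\bar\eta}$ for $\mathsf P=\mathrm{SE}$. Put $$C_{\mathrm{sched}}^{\mathrm{KT}}=48\left((\varepsilon+1)\left(1+\tfrac{2}{\log2}\right)+1\right),\qquad C_{\mathrm{sched}}^{\mathrm{SE}}=4e^{3/2}(2\varepsilon+1),\qquad C^{\mathsf P}=3\left(2+\frac\mu4\right)\frac{C^{\mathsf P}_{\mathrm{sched}}}{2}\sqrt N.$$ Then for every $u\in\mathcal H$ and every integer $T>0$ the random variable $R_T^{\mathrm{net}}(u)$ is integrable and $$\mathbb E\,R_T^{\mathrm{net}}(u)\le F_T^*(\|u\|)+\varepsilon+C^{\mathsf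 P}\sqrt T .$$ -/

import Mathlib

open MeasureTheory ProbabilityTheory
open scoped BigOperators

noncomputable section

namespace DecoEF

/-! ### Communication graph and gossip matrix -/

/-- A valid gossip matrix for the graph `G` on the agents `Fin N`: nonnegative, symmetric, doubly
stochastic, with off-diagonal support exactly the edge set and positive self-weights. -/
structure IsGossipMatrix {N : ℕ} (G : SimpleGraph (Fin N)) (W : Matrix (Fin N) (Fin N) ℝ) :
    Prop where
  symm : W.IsSymm
  nonneg : ∀ i j, 0 ≤ W i j
  row_sum : ∀ i, ∑ j, W i j = 1
  col_sum : ∀ j, ∑ i, W i j = 1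
  pos_of_adj : ∀ i j, G.Adj i j → 0 < W i j
  eq_zero_of_not_adj : ∀ i j, i ≠ j → ¬ G.Adj i j → W i j = 0
  diag_pos : ∀ i, 0 < W i i

/-- `ρ ∈ [0,1)` is a zero-mean contraction factor of `W` in the `ℓ²` norm on `ℝ^N`. -/
structure IsContractionFactor {N : ℕ} (W : Matrix (Fin N) (Fin N) ℝ) (ρ : ℝ) : Prop where
  nonneg : 0 ≤ ρ
  lt_one : ρ < 1
  contracts : ∀ z : Fin N → ℝ, ∑ n, z n = 0 →
    ‖WithLp.toLp 2 (W.mulVec z)‖ ≤ ρ * ‖WithLp.toLp 2 z‖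

/-! ### Compressors -/

/-- `C` is a randomized compressor on `H` with mean-square residual parameter `α`, where `P` is the
law on the sample space `Ω`. The mean square is a Lebesgue integral in `[0,∞]`, so the bound includes
finiteness. When `H` is separable, `measurable` is just joint measurability of `C`. -/
structure IsCompressor {Ω H : Type*} [MeasurableSpace Ω] [NormedAddCommGroup H]
    [MeasurableSpace H] [BorelSpace H] (P : Measure Ω) (C : Ω → H → H) (α : ℝ) : Prop where
  nonneg : 0 ≤ α
  lt_one : α < 1
  measurable : ∀ K : Set H, TopologicalSpace.IsSeparable K →
    StronglyMeasurable (fun p : Ω × K => C p.1 (p.2 : H))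
  residual : ∀ v : H, ∫⁻ ω, ‖C ω v - v‖ₑ ^ 2 ∂P ≤ ENNReal.ofReal (α * ‖v‖ ^ 2)

/-! ### Coin-betting potentials and predictions -/

/-- The Krichevsky-Trofimov potential with endowment `ε`. -/
def potentialKT (ε : ℝ) (t : ℕ) (x : ℝ) : ℝ :=
  ε * (2 ^ t * Real.Gamma (((t : ℝ) + 1) / 2 + x / 2) * Real.Gamma (((t : ℝ) + 1) / 2 - x / 2) /
    (Real.pi * (t.factorial : ℝ)))

/-- The shifted-exponential potential with endowment `ε`. -/
def potentialSE (ε : ℝ) (t : ℕ) (x : ℝ) : ℝ :=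
  ε / Real.sqrt ((t : ℝ) + 1) * Real.exp (x ^ 2 / (2 * ((t : ℝ) + 1)))

/-- The two choices of potential. -/
inductive Kind
  | KT
  | SE

/-- The potential selected by the kind. -/
def potential : Kind → ℝ → ℕ → ℝ → ℝ
  | Kind.KT => potentialKT
  | Kind.SE => potentialSE

/-- The betting fraction `β_t`. -/
def betFraction (F : ℕ → ℝ → ℝ) (t : ℕ) (x : ℝ) : ℝ :=
  (F t (x + 1) - F t (x - 1)) / (F t (x + 1) + F t (x - 1))

/-- The coin-betting function `h_t = β_t F_{t-1}`, used for `t ≥ 1` only. -/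
def betFunction (F : ℕ → ℝ → ℝ) (t : ℕ) (x : ℝ) : ℝ :=
  betFraction F t x * F (t - 1) x

/-- The restricted Fenchel conjugate `F_T^*(θ) = sup_{0 ≤ s ≤ T} (θ s - F_T(s))`. -/
def conjugate (F : ℕ → ℝ → ℝ) (T : ℕ) (θ : ℝ) : ℝ :=
  sSup ((fun s : ℝ => θ * s - F T s) '' Set.Icc 0 (T : ℝ))

section Hilbert

variable {H : Type*} [NormedAddCommGroup H] [InnerProductSpace ℝ H]

open Classical in
/-- The radial betting map `Bet_t`. -/
def bet (F : ℕ → ℝ → ℝ) (t : ℕ) (v : H) : H :=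
  if v = 0 then 0 else (betFunction F t ‖v‖ / ‖v‖) • v

/-- Clipping to the closed ball of radius `t`. -/
def clip (t : ℕ) (v : H) : H :=
  if ‖v‖ ≤ (t : ℝ) then v else ((t : ℝ) / ‖v‖) • v

/-- `g` is a subgradient of `f` at `x`. -/
def IsSubgradient (f : H → ℝ) (x g : H) : Prop :=
  ∀ y, f x + inner ℝ g (y - x) ≤ f y

/-! ### The algorithm

A state is a pair `(Z, Zhat)` of clean states and trackers of all agents. -/

/-- One compressed gossip substep; `ω n` is the compressor randomness of agent `n`. -/
def gossipStep {N : ℕ} {Ω : Type*} (C : Ω → H → H) (W : Matrix (Fin N) (Fin N) ℝ) (γ : ℝ)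
    (ω : Fin N → Ω) (p : (Fin N → H) × (Fin N → H)) : (Fin N → H) × (Fin N → H) :=
  let Zhat' : Fin N → H := fun n => p.2 n + C (ω n) (p.1 n - p.2 n)
  (fun n => p.1 n + γ • ∑ j, W n j • (Zhat' j - Zhat' n), Zhat')

/-- The state after `k` gossip substeps started from `p`; substep `k` uses the randomness `ω k`. -/
def gossip {N : ℕ} {Ω : Type*} (C : Ω → H → H) (W : Matrix (Fin N) (Fin N) ℝ) (γ : ℝ)
    (ω : ℕ → Fin N → Ω) (p : (Fin N → H) × (Fin N → H)) : ℕ → (Fin N → H) × (Fin N → H)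
  | 0 => p
  | k + 1 => gossipStep C W γ (ω k) (gossip C W γ ω p k)

/-- The state `(G_t, Ghat_t)` at the start of round `t`, for observed subgradients `g t n` and
compressor randomness `ω t k n`. It depends on `g r n` and `ω r k n` for `r < t` only. -/
def state {N : ℕ} {Ω : Type*} (C : Ω → H → H) (W : Matrix (Fin N) (Fin N) ℝ) (γ : ℝ) (q : ℕ → ℕ)
    (ω : ℕ → ℕ → Fin N → Ω) (g : ℕ → Fin N → H) : ℕ → (Fin N → H) × (Fin N → H)
  | 0 => (0, 0)
  | t + 1 => gossip C W γ (ω t)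
      (fun n => (state C W γ q ω g t).1 n + -g t n, (state C W γ q ω g t).2) (q t)

/-- The pair `(Z_t^k, Zhat_t^k)` inside round `t`, after `k` gossip substeps. -/
def innerState {N : ℕ} {Ω : Type*} (C : Ω → H → H) (W : Matrix (Fin N) (Fin N) ℝ) (γ : ℝ)
    (q : ℕ → ℕ) (ω : ℕ → ℕ → Fin N → Ω) (g : ℕ → Fin N → H) (t k : ℕ) :
    (Fin N → H) × (Fin N → H) :=
  gossip C W γ (ω t)
    (fun n => (state C W γ q ω g t).1 n + -g t n, (state C W γ q ω g t).2) k

/-- The payload `v_{n,t}^k = Z_{n,t}^k - Zhat_{n,t}^k` that agent `n` compresses. -/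
def payload {N : ℕ} {Ω : Type*} (C : Ω → H → H) (W : Matrix (Fin N) (Fin N) ℝ) (γ : ℝ)
    (q : ℕ → ℕ) (ω : ℕ → ℕ → Fin N → Ω) (g : ℕ → Fin N → H) (t k : ℕ) (n : Fin N) : H :=
  (innerState C W γ q ω g t k).1 n - (innerState C W γ q ω g t k).2 n

/-- The prediction `x_{n,t} = Bet_{t+1}(clip_t(G_{n,t}))`. -/
def prediction {N : ℕ} {Ω : Type*} (F : ℕ → ℝ → ℝ) (C : Ω → H → H)
    (W : Matrix (Fin N) (Fin N) ℝ) (γ : ℝ) (q : ℕ → ℕ) (ω : ℕ → ℕ → Fin N → Ω)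
    (g : ℕ → Fin N → H) (t : ℕ) (n : Fin N) : H :=
  bet F (t + 1) (clip t ((state C W γ q ω g t).1 n))

/-- The network loss at one round, from the local losses `ℓ n`. -/
def networkLoss {N : ℕ} (ℓ : Fin N → H → ℝ) (x : H) : ℝ :=
  1 / (N : ℝ) * ∑ n, ℓ n x

/-- The network regret of the predictions `x t n` against `u` after `T` rounds. -/
def networkRegret {N : ℕ} (ℓ : ℕ → Fin N → H → ℝ) (x : ℕ → Fin N → H) (T : ℕ) (u : H) : ℝ :=
  ∑ t ∈ Finset.range T, 1 / (N : ℝ) * ∑ n, networkLoss (ℓ t) (x t n) -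
    ∑ t ∈ Finset.range T, networkLoss (ℓ t) u

/-- A run of the algorithm on the probability space `(S, Q)`. The local losses `ℓ t n s` are convex
and `1`-Lipschitz and may be random (chosen by an adaptive adversary), `g t n s` is the observed
subgradient at the prediction. Each compressor draw `ω t k n` has law `P` and is fresh: it is
independent of the payload vector (of all agents) that its substep compresses. This holds in particular
when the draws are independent of the whole history before the substep. -/
structure IsRun {N : ℕ} {Ω S : Type*} [MeasurableSpace Ω] [MeasurableSpace S]
    [MeasurableSpace H] [BorelSpace H] (P : Measure Ω) (Q : Measure S) (F : ℕ → ℝ → ℝ)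
    (C : Ω → H → H) (W : Matrix (Fin N) (Fin N) ℝ) (γ : ℝ) (q : ℕ → ℕ)
    (ω : ℕ → ℕ → Fin N → S → Ω) (ℓ : ℕ → Fin N → S → H → ℝ) (g : ℕ → Fin N → S → H) :
    Prop where
  loss_convex : ∀ t n s, ConvexOn ℝ Set.univ (ℓ t n s)
  loss_lipschitz : ∀ t n s, LipschitzWith 1 (ℓ t n s)
  loss_measurable : ∀ t n x, Measurable (fun s => ℓ t n s x)
  grad_measurable : ∀ t n, StronglyMeasurable (g t n)
  subgradient : ∀ t n s, IsSubgradient (ℓ t n s)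
    (prediction F C W γ q (fun t k n => ω t k n s) (fun t n => g t n s) t n) (g t n s)
  draw_law : ∀ t k n, k < q t → MeasurePreserving (ω t k n) Q P
  draw_fresh : ∀ t k n, k < q t → IndepFun (ω t k n)
    (fun s => payload C W γ q (fun t k n => ω t k n s) (fun t n => g t n s) t k) Q

end Hilbert

/-! ### Constants -/

/-- The upper bound on the step size, with `μ = 1 - ρ`. -/
def stepBound (α μ : ℝ) : ℝ :=
  min 1 ((1 - Real.sqrt α) / (2 * Real.sqrt α * (1 + 4 / μ) + μ / 2))

/-- The lower bound on the slope `c` of the gossip schedule, with `η = 1 - γ μ / 2`. -/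
def slopeBound : Kind → ℝ → ℝ
  | Kind.KT, η => -(2 * Real.log 2) / Real.log η
  | Kind.SE, η => -3 / (2 * Real.log η)

/-- The constant `C_sched`. -/
def schedConst : Kind → ℝ → ℝ
  | Kind.KT, ε => 48 * ((ε + 1) * (1 + 2 / Real.log 2) + 1)
  | Kind.SE, ε => 4 * Real.exp (3 / 2) * (2 * ε + 1)

/-- The constant `C_net`, with `χ = μ / 4`. -/
def netConst (P : Kind) (ε μ : ℝ) (N : ℕ) : ℝ :=
  (2 + μ / 4) * (schedConst P ε / 2) * Real.sqrt N

/-- The constant `C_reg = 3 C_net`. -/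
def regConst (P : Kind) (ε μ : ℝ) (N : ℕ) : ℝ :=
  3 * netConst P ε μ N

end DecoEF

end

/-!
The regret splits into a centralized part and a consensus part.

For the centralized part, gossip with a doubly stochastic matrix preserves the network average of
the clean states (`IsGossipMatrix.average_state`), so the average state is minus the sum of the
averaged gradients, and the prediction made from it is that of a single coin-betting algorithm. Both
potentials are even, they are convex and increasing functions of `x ^ 2`, and they satisfy
`F_{t+1}(x + 1) + F_{t+1}(x - 1) ≤ 2 F_t(x)`. By convexity the worst gradient in a round is parallel
to the current state, so this scalar inequality bounds the wealth from below by the potential in any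
Hilbert space (`IsBettingPotential.potential_norm_add_le`), and Fenchel duality gives regret
`F_T^*(‖u‖) + ε` (`IsBettingPotential.sum_inner_bet_sub_le`). For the Krichevsky-Trofimov potential,
convexity in `x ^ 2` is read off from Euler's limit formula, which exhibits the product of two Gamma
values as a limit of products of the functions `1 / (b - x ^ 2)`.

For the consensus part, let `d` and `e` be the `L²` norms of the disagreement of the clean states
and of the tracking error. A fresh draw makes the compression error at most `√α * e` in `L²`, and
the step-size condition then makes `d + (μ / 4) * e` contract by `η = 1 - γ μ / 2` in each substep
(`lyapunov_gossipStep_le`). Hence, with the schedule `q t = ⌈c t⌉`, the disagreement at the start of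
round `t + 1` is of order `b ^ t`, where `b` is `1 / 4` or `exp (-3 / 2)`, an upper bound for `η ^
c` (`IsRun.lyapunov_state_le`). The prediction map of round `t` is Lipschitz with constant `A * r ^
t` (`IsBettingPotential.norm_bet_clip_sub_le`), and the slope of the schedule is large enough for `r
* b ≤ 1 / 2`. The total deviation of the predictions from the centralized one is therefore bounded
uniformly in `T`, which is stronger than the required `√T`.

The regret is bounded and measurable, hence integrable. No separability is needed: a strongly
measurable input has separable range, and a random Lipschitz loss is evaluated along simple
functions.
-/

namespace DecoEF

/-! ### The Gamma product in the squared variable -/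

theorem monotoneOn_inv_sub {b : ℝ} {S : Set ℝ} (hS : ∀ s ∈ S, s < b) :
    MonotoneOn (fun s : ℝ => (b - s)⁻¹) S := by
  intro x _ y hy hxy
  have := hS y hy
  exact inv_anti₀ (by linarith) (by linarith)

theorem convexOn_inv_sub {b : ℝ} {S : Set ℝ} (hSc : Convex ℝ S) (hS : ∀ s ∈ S, s < b) :
    ConvexOn ℝ S (fun s : ℝ => (b - s)⁻¹) := by
  refine ⟨hSc, fun x hx y hy p r hp hr hpr => ?_⟩
  have h := (convexOn_zpow (𝕜 := ℝ) (-1)).2 (Set.mem_Ioi.2 (sub_pos.2 (hS x hx)))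
    (Set.mem_Ioi.2 (sub_pos.2 (hS y hy))) hp hr hpr
  simp only [zpow_neg_one, smul_eq_mul] at h ⊢
  have e : b - (p * x + r * y) = p * (b - x) + r * (b - y) := by
    linear_combination (-b) * hpr
  rwa [e]

/-- Nonnegative increasing convex functions are closed under finite products. -/
theorem convexOn_monotoneOn_prod {S : Set ℝ} (hS : Convex ℝ S) (f : ℕ → ℝ → ℝ)
    (h0 : ∀ j, ∀ s ∈ S, 0 ≤ f j s) (hc : ∀ j, ConvexOn ℝ S (f j))
    (hm : ∀ j, MonotoneOn (f j) S) (n : ℕ) :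
    ConvexOn ℝ S (fun s => ∏ j ∈ Finset.range n, f j s) ∧
      MonotoneOn (fun s => ∏ j ∈ Finset.range n, f j s) S := by
  have hmono : ∀ n, MonotoneOn (fun s => ∏ j ∈ Finset.range n, f j s) S := fun n x hx y hy hxy =>
    Finset.prod_le_prod (fun j _ => h0 j x hx) (fun j _ => hm j hx hy hxy)
  refine ⟨?_, hmono n⟩
  induction n with
  | zero => simpa using convexOn_const (1 : ℝ) hS
  | succ n ih =>
    have := ih.mul (hc n) (fun s hs => Finset.prod_nonneg fun j _ => h0 j s hs)
      (fun s hs => h0 n s hs) ((hmono n).monovaryOn (hm n))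
    refine this.congr fun s _ => ?_
    simp [Finset.prod_range_succ]

/-- Euler's limit formula for `Γ(a + √s / 2) Γ(a - √s / 2)`, whose approximants are rational in
`s`. -/
theorem tendsto_gamma_mul_gamma (a : ℝ) {s : ℝ} (hs : 0 ≤ s) :
    Filter.Tendsto (fun n : ℕ => ((n : ℝ) ^ (2 * a) * (n.factorial : ℝ) ^ 2 * 4 ^ (n + 1)) *
      ∏ j ∈ Finset.range (n + 1), ((2 * (a + j)) ^ 2 - s)⁻¹) Filter.atTop
      (nhds (Real.Gamma (a + √s / 2) * Real.Gamma (a - √s / 2))) := by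
  refine ((Real.GammaSeq_tendsto_Gamma (a + √s / 2)).mul
    (Real.GammaSeq_tendsto_Gamma (a - √s / 2))).congr' ?_
  filter_upwards [Filter.eventually_gt_atTop 0] with n hn
  have hn' : (0 : ℝ) < n := by exact_mod_cast hn
  rw [Real.GammaSeq, Real.GammaSeq, div_mul_div_comm, ← Finset.prod_mul_distrib,
    Finset.prod_inv_distrib]
  have hp : ∏ j ∈ Finset.range (n + 1), (a + √s / 2 + (j : ℝ)) * (a - √s / 2 + j) =
      (4 ^ (n + 1))⁻¹ * ∏ j ∈ Finset.range (n + 1), ((2 * (a + j)) ^ 2 - s) := by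
    have : ((4 : ℝ) ^ (n + 1))⁻¹ = ∏ _j ∈ Finset.range (n + 1), (4 : ℝ)⁻¹ := by simp
    rw [this, ← Finset.prod_mul_distrib]
    refine Finset.prod_congr rfl fun j _ => ?_
    have := Real.sq_sqrt hs
    linear_combination (-1 / 4) * this
  have hr : (n : ℝ) ^ (2 * a) = (n : ℝ) ^ (a + √s / 2) * (n : ℝ) ^ (a - √s / 2) := by
    rw [← Real.rpow_add hn']
    congr 1; ring
  rw [hp, hr, div_eq_mul_inv, mul_inv, inv_inv]
  ring

theorem convexOn_monotoneOn_gamma_mul_gamma {a : ℝ} (ha : 0 < a) :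
    ConvexOn ℝ (Set.Ico 0 ((2 * a) ^ 2))
        (fun s => Real.Gamma (a + √s / 2) * Real.Gamma (a - √s / 2)) ∧
      MonotoneOn (fun s => Real.Gamma (a + √s / 2) * Real.Gamma (a - √s / 2))
        (Set.Ico 0 ((2 * a) ^ 2)) := by
  set S : Set ℝ := Set.Ico 0 ((2 * a) ^ 2)
  have hSc : Convex ℝ S := convex_Ico _ _
  have hlt : ∀ j : ℕ, ∀ s ∈ S, s < (2 * (a + j)) ^ 2 := fun j s hs => by
    refine hs.2.trans_le ?_
    have : (0 : ℝ) ≤ j := by positivity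
    gcongr
    linarith
  have key := convexOn_monotoneOn_prod hSc (fun j s => ((2 * (a + j)) ^ 2 - s)⁻¹)
    (fun j s hs => (inv_pos.2 (sub_pos.2 (hlt j s hs))).le)
    (fun j => convexOn_inv_sub hSc (hlt j)) (fun j => monotoneOn_inv_sub (hlt j))
  have hK : ∀ n : ℕ, 0 ≤ (n : ℝ) ^ (2 * a) * (n.factorial : ℝ) ^ 2 * 4 ^ (n + 1) :=
    fun n => by positivity
  refine ⟨⟨hSc, fun x hx y hy p r hp hr hpr => ?_⟩, fun x hx y hy hxy => ?_⟩
  · have hz := hSc hx hy hp hr hpr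
    refine le_of_tendsto_of_tendsto' (tendsto_gamma_mul_gamma a hz.1)
      (((tendsto_gamma_mul_gamma a hx.1).const_smul p).add
        ((tendsto_gamma_mul_gamma a hy.1).const_smul r)) fun n => ?_
    have := mul_le_mul_of_nonneg_left ((key (n + 1)).1.2 hx hy hp hr hpr) (hK n)
    refine this.trans (le_of_eq ?_)
    simp only [smul_eq_mul]
    ring
  · exact le_of_tendsto_of_tendsto' (tendsto_gamma_mul_gamma a hx.1)
      (tendsto_gamma_mul_gamma a hy.1)
      fun n => mul_le_mul_of_nonneg_left ((key (n + 1)).2 hx hy hxy) (hK n)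

/-! ### Coin-betting potentials -/

theorem eq_comp_sqrt_sq_of_even {f : ℝ → ℝ} (he : ∀ x, f (-x) = f x) (x : ℝ) :
    f x = f √(x ^ 2) := by
  rw [Real.sqrt_sq_eq_abs]
  rcases abs_choice x with h | h <;> rw [h]
  exact (he x).symm

theorem convexOn_Ioo_of_comp_sqrt {f : ℝ → ℝ} {b : ℝ} (he : ∀ x, f (-x) = f x)
    (hc : ConvexOn ℝ (Set.Ico 0 (b ^ 2)) fun s => f √s)
    (hm : MonotoneOn (fun s => f √s) (Set.Ico 0 (b ^ 2))) : ConvexOn ℝ (Set.Ioo (-b) b) f := by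
  have hmem : ∀ x ∈ Set.Ioo (-b) b, x ^ 2 ∈ Set.Ico 0 (b ^ 2) :=
    fun x hx => ⟨sq_nonneg x, by nlinarith [hx.1, hx.2]⟩
  refine ⟨convex_Ioo _ _, fun x hx y hy p q hp hq hpq => ?_⟩
  have hz := (convex_Ioo _ _) hx hy hp hq hpq
  rw [eq_comp_sqrt_sq_of_even he (p • x + q • y), eq_comp_sqrt_sq_of_even he x,
    eq_comp_sqrt_sq_of_even he y]
  refine (hm (hmem _ hz) ((convex_Ico _ _) (hmem x hx) (hmem y hy) hp hq hpq) ?_).trans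
    (hc.2 (hmem x hx) (hmem y hy) hp hq hpq)
  exact (even_two.convexOn_pow (𝕜 := ℝ)).2 (Set.mem_univ x) (Set.mem_univ y) hp hq hpq

theorem monotoneOn_Ico_of_comp_sqrt {f : ℝ → ℝ} {b : ℝ} (he : ∀ x, f (-x) = f x)
    (hm : MonotoneOn (fun s => f √s) (Set.Ico 0 (b ^ 2))) : MonotoneOn f (Set.Ico 0 b) := by
  intro x hx y hy hxy
  rw [eq_comp_sqrt_sq_of_even he x, eq_comp_sqrt_sq_of_even he y]
  exact hm ⟨sq_nonneg x, pow_lt_pow_left₀ hx.2 hx.1 two_ne_zero⟩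
    ⟨sq_nonneg y, pow_lt_pow_left₀ hy.2 hy.1 two_ne_zero⟩ (pow_le_pow_left₀ hx.1 hxy 2)

/-- The properties of the two potentials on which the regret bound rests. The constants `A` and `r`
measure growth: the coin-betting map on the ball of radius `t` turns out to be bounded by
`A * r ^ t` and Lipschitz with that constant. -/
structure IsBettingPotential (F : ℕ → ℝ → ℝ) (ε A r : ℝ) : Prop where
  zero : F 0 0 = ε
  even : ∀ t x, F t (-x) = F t x
  pos : ∀ t : ℕ, ∀ x : ℝ, |x| < t + 1 → 0 < F t x
  convexOn_sqrt : ∀ t : ℕ, ConvexOn ℝ (Set.Ico 0 (((t : ℝ) + 1) ^ 2)) (fun s => F t √s)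
  monotoneOn_sqrt : ∀ t : ℕ, MonotoneOn (fun s => F t √s) (Set.Ico 0 (((t : ℝ) + 1) ^ 2))
  /-- The potential is a supermartingale under a fair coin. -/
  fair : ∀ t : ℕ, ∀ x : ℝ, |x| ≤ t → F (t + 1) (x + 1) + F (t + 1) (x - 1) ≤ 2 * F t x
  fraction_nonneg : ∀ t : ℕ, ∀ x : ℝ, 0 ≤ x → x ≤ t → 0 ≤ betFraction F (t + 1) x
  fraction_lipschitz : ∀ t : ℕ, ∀ x y : ℝ, 0 ≤ x → x ≤ y → y ≤ t →
    |betFraction F (t + 1) y - betFraction F (t + 1) x| ≤ y - x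
  growth : ∀ t : ℕ, ∃ M L : ℝ, 0 ≤ L ∧ M + L ≤ A * r ^ t ∧ (∀ x : ℝ, 0 ≤ x → x ≤ t → F t x ≤ M) ∧
    ∀ x y : ℝ, 0 ≤ x → x ≤ y → y ≤ t → F t y - F t x ≤ L * (y - x)

/-! ### The Krichevsky-Trofimov potential -/

theorem potentialKT_succ_add_one {ε : ℝ} {t : ℕ} {x : ℝ} (hx : |x| < t + 1) :
    potentialKT ε (t + 1) (x + 1) = (t + 1 + x) / (t + 1) * potentialKT ε t x := by
  have h := abs_lt.1 hx
  have e1 : ((t + 1 : ℕ) + 1 : ℝ) / 2 + (x + 1) / 2 = ((t : ℝ) + 1) / 2 + x / 2 + 1 := by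
    push_cast; ring
  have e2 : ((t + 1 : ℕ) + 1 : ℝ) / 2 - (x + 1) / 2 = ((t : ℝ) + 1) / 2 - x / 2 := by
    push_cast; ring
  rw [potentialKT, potentialKT, e1, e2, Real.Gamma_add_one (by linarith), Nat.factorial_succ]
  have : (t.factorial : ℝ) ≠ 0 := by positivity
  push_cast
  field_simp
  ring

theorem potentialKT_neg (ε : ℝ) (t : ℕ) (x : ℝ) : potentialKT ε t (-x) = potentialKT ε t x := by
  unfold potentialKT
  rw [neg_div, ← sub_eq_add_neg, sub_neg_eq_add]
  ring

theorem potentialKT_succ_sub_one {ε : ℝ} {t : ℕ} {x : ℝ} (hx : |x| < t + 1) :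
    potentialKT ε (t + 1) (x - 1) = (t + 1 - x) / (t + 1) * potentialKT ε t x := by
  have := potentialKT_succ_add_one (ε := ε) (t := t) (x := -x) (by rwa [abs_neg])
  rwa [potentialKT_neg, ← potentialKT_neg, neg_add, neg_neg, ← sub_eq_add_neg,
    ← sub_eq_add_neg] at this

theorem potentialKT_pos {ε : ℝ} (hε : 0 < ε) {t : ℕ} {x : ℝ} (hx : |x| < t + 1) :
    0 < potentialKT ε t x := by
  have h := abs_lt.1 hx
  have h1 : 0 < Real.Gamma (((t : ℝ) + 1) / 2 + x / 2) := Real.Gamma_pos_of_pos (by linarith)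
  have h2 : 0 < Real.Gamma (((t : ℝ) + 1) / 2 - x / 2) := Real.Gamma_pos_of_pos (by linarith)
  unfold potentialKT
  positivity

theorem betFraction_potentialKT {ε : ℝ} (hε : 0 < ε) {t : ℕ} {x : ℝ} (hx : |x| < t + 1) :
    betFraction (potentialKT ε) (t + 1) x = x / (t + 1) := by
  have h := potentialKT_pos hε hx
  rw [betFraction, potentialKT_succ_add_one hx, potentialKT_succ_sub_one hx]
  have : (0 : ℝ) < t + 1 := by positivity
  rw [← sub_mul, ← add_mul, mul_div_mul_right _ _ h.ne']
  field_simp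
  ring

theorem potentialKT_zero_zero (ε : ℝ) : potentialKT ε 0 0 = ε := by
  have := Real.sq_sqrt Real.pi_pos.le
  simp only [potentialKT, Nat.cast_zero, zero_add, zero_div, add_zero, sub_zero,
    Real.Gamma_one_half_eq, pow_zero, one_mul, Nat.factorial_zero, Nat.cast_one, mul_one]
  rw [← sq, this, div_self Real.pi_ne_zero, mul_one]

theorem potentialKT_self_le {ε : ℝ} (hε : 0 < ε) (t : ℕ) : potentialKT ε t t ≤ ε * 2 ^ t := by
  induction t with
  | zero => simp [potentialKT_zero_zero]
  | succ t ih =>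
    have hx : |(t : ℝ)| < t + 1 := by rw [abs_of_nonneg (by positivity)]; linarith
    have h := potentialKT_pos hε hx
    push_cast
    rw [potentialKT_succ_add_one hx, pow_succ]
    have : ((t : ℝ) + 1 + t) / (t + 1) ≤ 2 := by
      rw [div_le_iff₀ (by positivity)]; linarith
    nlinarith

/-- A bound at a point strictly between `t` and the pole `t + 1`, which controls the slope of the
potential below `t`. -/
theorem potentialKT_add_half_le {ε : ℝ} (hε : 0 < ε) (t : ℕ) :
    potentialKT ε t (t + 1 / 2) ≤ 3 / 2 * ε * 2 ^ t := by
  induction t with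
  | zero =>
    -- By the reflection formula the value at `t = 0` is `ε * √2`.
    have hG := Real.Gamma_mul_Gamma_one_sub (1 / 4)
    have hs : √2 * √2 = 2 := Real.mul_self_sqrt zero_le_two
    have e1 : (((0 : ℕ) : ℝ) + 1) / 2 + (((0 : ℕ) : ℝ) + 1 / 2) / 2 = 1 - 1 / 4 := by norm_num
    have e2 : (((0 : ℕ) : ℝ) + 1) / 2 - (((0 : ℕ) : ℝ) + 1 / 2) / 2 = 1 / 4 := by norm_num
    have e3 : Real.pi * (1 / 4) = Real.pi / 4 := by ring
    rw [e3, Real.sin_pi_div_four] at hG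
    have h2 : √2 ≤ 3 / 2 := by
      rw [Real.sqrt_le_left (by norm_num)]; norm_num
    have hp : 0 < √2 := by positivity
    rw [potentialKT, e1, e2, mul_assoc (2 ^ 0), mul_comm (Real.Gamma _), hG]
    have : 2 ^ 0 * (Real.pi / (√2 / 2)) / (Real.pi * (Nat.factorial 0 : ℝ)) = √2 := by
      have := Real.pi_pos
      simp only [Nat.factorial_zero, Nat.cast_one]
      field_simp
      nlinarith
    rw [this]
    nlinarith
  | succ t ih =>
    have hx : |(t : ℝ) + 1 / 2| < t + 1 := by rw [abs_of_nonneg (by positivity)]; linarith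
    have h := potentialKT_pos hε hx
    have e : ((t + 1 : ℕ) : ℝ) + 1 / 2 = (t : ℝ) + 1 / 2 + 1 := by push_cast; ring
    rw [e, potentialKT_succ_add_one hx, pow_succ]
    have : ((t : ℝ) + 1 + (t + 1 / 2)) / (t + 1) ≤ 2 := by
      rw [div_le_iff₀ (by positivity)]; linarith
    nlinarith

theorem potentialKT_sqrt_eq (ε : ℝ) (t : ℕ) (s : ℝ) :
    potentialKT ε t √s = ε * 2 ^ t / (Real.pi * t.factorial) *
      (Real.Gamma (((t : ℝ) + 1) / 2 + √s / 2) * Real.Gamma (((t : ℝ) + 1) / 2 - √s / 2)) := by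
  unfold potentialKT
  ring

theorem isBettingPotential_potentialKT {ε : ℝ} (hε : 0 < ε) :
    IsBettingPotential (potentialKT ε) ε (4 * ε) 2 := by
  have hsq : ∀ t : ℕ, (2 * (((t : ℝ) + 1) / 2)) ^ 2 = ((t : ℝ) + 1) ^ 2 := fun t => by ring
  have hG := fun t : ℕ => convexOn_monotoneOn_gamma_mul_gamma
    (a := ((t : ℝ) + 1) / 2) (by positivity)
  simp only [hsq] at hG
  have hK : ∀ t : ℕ, 0 ≤ ε * 2 ^ t / (Real.pi * t.factorial) := fun t => by positivity
  have hconv : ∀ t : ℕ, ConvexOn ℝ (Set.Ico 0 (((t : ℝ) + 1) ^ 2)) fun s => potentialKT ε t √s := by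
    intro t
    simp only [potentialKT_sqrt_eq]
    exact (hG t).1.smul (hK t)
  have hmono : ∀ t : ℕ, MonotoneOn (fun s => potentialKT ε t √s)
      (Set.Ico 0 (((t : ℝ) + 1) ^ 2)) := by
    intro t x hx y hy hxy
    simp only [potentialKT_sqrt_eq]
    exact mul_le_mul_of_nonneg_left ((hG t).2 hx hy hxy) (hK t)
  have habs : ∀ t : ℕ, ∀ x : ℝ, |x| ≤ t → |x| < t + 1 := fun t x hx => by linarith
  have hfair : ∀ t : ℕ, ∀ x : ℝ, |x| ≤ t →
      potentialKT ε (t + 1) (x + 1) + potentialKT ε (t + 1) (x - 1) ≤ 2 * potentialKT ε t x := by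
    intro t x hx
    rw [potentialKT_succ_add_one (habs t x hx), potentialKT_succ_sub_one (habs t x hx)]
    apply le_of_eq
    field_simp
    ring
  have hfn : ∀ t : ℕ, ∀ x : ℝ, 0 ≤ x → x ≤ t → 0 ≤ betFraction (potentialKT ε) (t + 1) x := by
    intro t x h0 h1
    rw [betFraction_potentialKT hε (habs t x (by rwa [abs_of_nonneg h0]))]
    positivity
  have hfl : ∀ t : ℕ, ∀ x y : ℝ, 0 ≤ x → x ≤ y → y ≤ t →
      |betFraction (potentialKT ε) (t + 1) y - betFraction (potentialKT ε) (t + 1) x| ≤ y - x := by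
    intro t x y h0 h1 h2
    rw [betFraction_potentialKT hε (habs t x (by rw [abs_of_nonneg h0]; linarith)),
      betFraction_potentialKT hε (habs t y (by rwa [abs_of_nonneg (h0.trans h1)])), ← sub_div,
      abs_of_nonneg (div_nonneg (by linarith) (by positivity))]
    exact div_le_self (by linarith) (by have : (0:ℝ) ≤ t := by positivity
                                        linarith)
  refine ⟨potentialKT_zero_zero ε, potentialKT_neg ε, fun t x => potentialKT_pos hε, hconv, hmono,
    hfair, hfn, hfl, fun t => ⟨ε * 2 ^ t, 3 * ε * 2 ^ t, by positivity, le_of_eq (by ring),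
      fun x h0 h1 => ?_, fun x y h0 h1 h2 => ?_⟩⟩
  · exact (monotoneOn_Ico_of_comp_sqrt (potentialKT_neg ε t) (hmono t) ⟨h0, by linarith⟩
      ⟨h0.trans h1, by linarith⟩ h1).trans (potentialKT_self_le hε t)
  · rcases h1.eq_or_lt with rfl | hlt
    · simp
    -- By convexity the slope of `F_t` below `t` is at most its slope up to `t + 1 / 2`.
    have hc := convexOn_Ioo_of_comp_sqrt (potentialKT_neg ε t) (hconv t) (hmono t)
    have hsl := hc.slope_mono_adjacent
      (x := x) (y := y) (z := t + 1 / 2) ⟨by linarith, by linarith⟩ ⟨by linarith, by linarith⟩ hlt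
      (by linarith)
    have hy := potentialKT_pos hε (t := t) (x := y) (by rw [abs_of_nonneg (by linarith)]; linarith)
    have hb := potentialKT_add_half_le hε t
    have h3 : (potentialKT ε t (t + 1 / 2) - potentialKT ε t y) / ((t : ℝ) + 1 / 2 - y) ≤
        3 * ε * 2 ^ t := by
      rw [div_le_iff₀ (by linarith)]
      have : (0 : ℝ) < 3 * ε * 2 ^ t := by positivity
      nlinarith
    have := hsl.trans h3
    rwa [div_le_iff₀ (by linarith)] at this

/-! ### The shifted-exponential potential -/

theorem abs_tanh_sub_tanh_le {x y : ℝ} (hxy : x ≤ y) :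
    |Real.tanh y - Real.tanh x| ≤ y - x := by
  have hd : ∀ z : ℝ, HasDerivAt Real.tanh (1 / Real.cosh z ^ 2) z := by
    intro z
    have h := (Real.hasDerivAt_sinh z).div (Real.hasDerivAt_cosh z) (Real.cosh_pos z).ne'
    have e : Real.cosh z * Real.cosh z - Real.sinh z * Real.sinh z = 1 := by
      have := Real.cosh_sq z
      nlinarith
    rw [e] at h
    refine h.congr_of_eventuallyEq (Filter.Eventually.of_forall fun w => ?_)
    simp [Real.tanh_eq_sinh_div_cosh]
  have := convex_univ.norm_image_sub_le_of_norm_hasDerivWithin_le (f := Real.tanh) (C := 1)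
    (x := x) (y := y) (fun z _ => (hd z).hasDerivWithinAt) (fun z _ => by
      rw [Real.norm_of_nonneg (by positivity)]
      exact div_le_one_of_le₀ (one_le_pow₀ (Real.one_le_cosh z)) (by positivity))
    (Set.mem_univ _) (Set.mem_univ _)
  simpa [abs_of_nonneg (sub_nonneg.2 hxy)] using this

theorem potentialSE_pos {ε : ℝ} (hε : 0 < ε) (t : ℕ) (x : ℝ) : 0 < potentialSE ε t x := by
  unfold potentialSE
  positivity

theorem potentialSE_add_eq (ε : ℝ) (t : ℕ) (x d : ℝ) (hd : d ^ 2 = 1) :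
    potentialSE ε (t + 1) (x + d) = ε / √((t : ℝ) + 2) * Real.exp ((x ^ 2 + 1) / (2 * (t + 2))) *
      Real.exp (d * (x / (t + 2))) := by
  unfold potentialSE
  rw [mul_assoc, ← Real.exp_add]
  have e1 : ((t + 1 : ℕ) : ℝ) + 1 = t + 2 := by push_cast; ring
  rw [e1]
  congr 2
  field_simp
  linear_combination hd

theorem betFraction_potentialSE {ε : ℝ} (hε : 0 < ε) (t : ℕ) (x : ℝ) :
    betFraction (potentialSE ε) (t + 1) x = Real.tanh (x / (t + 2)) := by
  rw [betFraction, sub_eq_add_neg x 1, potentialSE_add_eq ε t x 1 (by norm_num),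
    potentialSE_add_eq ε t x (-1) (by norm_num), ← mul_sub, ← mul_add,
    mul_div_mul_left _ _ (by positivity), Real.tanh_eq_sinh_div_cosh, Real.sinh_eq, Real.cosh_eq,
    div_div_div_cancel_right₀ two_ne_zero, one_mul, neg_one_mul]

/-- The factor `√(n / (n - 1))` gained from one round to the next pays for the unit stake. -/
theorem exp_inv_two_mul_le {n : ℝ} (hn : 1 < n) : Real.exp (1 / (2 * n)) * √(n - 1) ≤ √n := by
  apply Real.le_sqrt_of_sq_le
  rw [mul_pow, Real.sq_sqrt (by linarith), ← Real.exp_nat_mul]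
  have h1 : (n - 1) / n ≤ Real.exp (-(1 / n)) := by
    have := Real.add_one_le_exp (-(1 / n))
    have e : (n - 1) / n = -(1 / n) + 1 := by field_simp; ring
    rwa [e]
  have h2 : ((2 : ℕ) : ℝ) * (1 / (2 * n)) = 1 / n := by push_cast; field_simp
  rw [div_le_iff₀ (by linarith)] at h1
  rw [h2]
  calc Real.exp (1 / n) * (n - 1) ≤ Real.exp (1 / n) * (Real.exp (-(1 / n)) * n) := by gcongr
    _ = n := by rw [← mul_assoc, ← Real.exp_add]; simp

theorem potentialSE_fair {ε : ℝ} (hε : 0 < ε) (t : ℕ) (x : ℝ) :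
    potentialSE ε (t + 1) (x + 1) + potentialSE ε (t + 1) (x - 1) ≤ 2 * potentialSE ε t x := by
  rw [sub_eq_add_neg x 1, potentialSE_add_eq ε t x 1 (by norm_num),
    potentialSE_add_eq ε t x (-1) (by norm_num), ← mul_add, one_mul, neg_one_mul]
  have hc : Real.exp (x / (t + 2)) + Real.exp (-(x / (t + 2))) ≤
      2 * Real.exp ((x / (t + 2)) ^ 2 / 2) := by
    have := Real.cosh_le_exp_half_sq (x / (t + 2))
    rw [Real.cosh_eq] at this
    linarith
  have hs := exp_inv_two_mul_le (n := (t : ℝ) + 2) (by have : (0 : ℝ) ≤ t := by positivity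
                                                       linarith)
  rw [show (t : ℝ) + 2 - 1 = t + 1 by ring] at hs
  have hx : x ^ 2 / (2 * (t + 2)) + (x / ((t : ℝ) + 2)) ^ 2 / 2 ≤ x ^ 2 / (2 * (t + 1)) := by
    have : x ^ 2 / (2 * (t + 1)) - (x ^ 2 / (2 * (t + 2)) + (x / ((t : ℝ) + 2)) ^ 2 / 2) =
        x ^ 2 / (2 * (t + 1) * (t + 2) ^ 2) := by field_simp; ring
    have h0 : 0 ≤ x ^ 2 / (2 * ((t : ℝ) + 1) * (t + 2) ^ 2) := by positivity
    linarith
  calc ε / √((t : ℝ) + 2) * Real.exp ((x ^ 2 + 1) / (2 * (t + 2))) *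
        (Real.exp (x / (t + 2)) + Real.exp (-(x / (t + 2))))
      ≤ ε / √((t : ℝ) + 2) * Real.exp ((x ^ 2 + 1) / (2 * (t + 2))) *
        (2 * Real.exp ((x / (t + 2)) ^ 2 / 2)) := by gcongr
    _ = 2 * (ε * (Real.exp (1 / (2 * ((t : ℝ) + 2))) / √((t : ℝ) + 2)) *
        Real.exp (x ^ 2 / (2 * (t + 2)) + (x / ((t : ℝ) + 2)) ^ 2 / 2)) := by
      rw [add_div, Real.exp_add, Real.exp_add]; ring
    _ ≤ 2 * (ε * (1 / √((t : ℝ) + 1)) * Real.exp (x ^ 2 / (2 * (t + 1)))) := by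
      gcongr 2 * (ε * ?_ * ?_)
      · rw [div_le_div_iff₀ (by positivity) (by positivity)]
        linarith
      · exact Real.exp_le_exp.2 hx
    _ = 2 * potentialSE ε t x := by unfold potentialSE; ring

theorem isBettingPotential_potentialSE {ε : ℝ} (hε : 0 < ε) :
    IsBettingPotential (potentialSE ε) ε (2 * ε) (Real.exp (1 / 2)) := by
  have hsq : ∀ t : ℕ, ∀ s ∈ Set.Ico (0 : ℝ) (((t : ℝ) + 1) ^ 2),
      potentialSE ε t √s = ε / √((t : ℝ) + 1) * Real.exp (s / (2 * (t + 1))) := fun t s hs => by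
    rw [potentialSE, Real.sq_sqrt hs.1]
  refine ⟨by simp [potentialSE], fun t x => by simp [potentialSE],
    fun t x _ => potentialSE_pos hε t x,
    fun t => ⟨convex_Ico _ _, fun x hx y hy p q hp hq hpq => ?_⟩, fun t x hx y hy hxy => ?_,
    fun t x _ => potentialSE_fair hε t x, fun t x h0 _ => ?_, fun t x y h0 h1 _ => ?_, fun t =>
    ⟨ε * Real.exp (t / 2), ε * Real.exp (t / 2), by positivity, ?_, ?_⟩⟩
  · beta_reduce
    rw [hsq t x hx, hsq t y hy, hsq t _ ((convex_Ico _ _) hx hy hp hq hpq)]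
    have := convexOn_exp.2 (Set.mem_univ (x / (2 * ((t : ℝ) + 1))))
      (Set.mem_univ (y / (2 * ((t : ℝ) + 1)))) hp hq hpq
    simp only [smul_eq_mul] at this ⊢
    have e : (p * x + q * y) / (2 * ((t : ℝ) + 1)) =
      p * (x / (2 * (t + 1))) + q * (y / (2 * (t + 1))) := by ring
    rw [e]
    refine (mul_le_mul_of_nonneg_left this (by positivity : 0 ≤ ε / √((t : ℝ) + 1))).trans
      (le_of_eq ?_)
    ring
  · simp only [hsq t x hx, hsq t y hy]
    gcongr
  · rw [betFraction_potentialSE hε, Real.tanh_eq_sinh_div_cosh]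
    exact div_nonneg (Real.sinh_nonneg_iff.2 (by positivity)) (Real.cosh_pos _).le
  · rw [betFraction_potentialSE hε, betFraction_potentialSE hε]
    refine (abs_tanh_sub_tanh_le (by gcongr)).trans ?_
    rw [← sub_div]
    exact div_le_self (by linarith) (by have : (0 : ℝ) ≤ t := by positivity
                                        linarith)
  · rw [← Real.exp_nat_mul, mul_one_div]
    linarith
  · have h0 : (0 : ℝ) ≤ t := by positivity
    have hM : ∀ x : ℝ, 0 ≤ x → x ≤ t → potentialSE ε t x ≤ ε * Real.exp (t / 2) := by
      intro x hx0 hx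
      unfold potentialSE
      refine mul_le_mul (div_le_self hε.le ?_) (Real.exp_le_exp.2 ?_) (by positivity) hε.le
      · rw [Real.one_le_sqrt]; linarith
      · rw [div_le_div_iff₀ (by positivity) (by norm_num)]
        nlinarith
    refine ⟨hM, fun x y hx hxy hy => ?_⟩
    have hFy := hM y (hx.trans hxy) hy
    -- `exp b - exp a ≤ (b - a) * exp b`, with `b - a ≤ y - x`.
    set a := x ^ 2 / (2 * ((t : ℝ) + 1)) with ha
    set b := y ^ 2 / (2 * ((t : ℝ) + 1)) with hb
    have hba : b - a ≤ y - x := by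
      rw [ha, hb, ← sub_div, div_le_iff₀ (by positivity)]
      nlinarith
    have h1 : Real.exp b * (a - b + 1) ≤ Real.exp a := by
      have := mul_le_mul_of_nonneg_left (Real.add_one_le_exp (a - b)) (Real.exp_pos b).le
      rwa [← Real.exp_add, add_sub_cancel] at this
    have hK : 0 ≤ ε / √((t : ℝ) + 1) := by positivity
    calc potentialSE ε t y - potentialSE ε t x
        = ε / √((t : ℝ) + 1) * (Real.exp b - Real.exp a) := by unfold potentialSE; ring
      _ ≤ ε / √((t : ℝ) + 1) * ((b - a) * Real.exp b) :=
        mul_le_mul_of_nonneg_left (by linarith) hK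
      _ = (b - a) * potentialSE ε t y := by unfold potentialSE; ring
      _ ≤ (y - x) * potentialSE ε t y :=
        mul_le_mul_of_nonneg_right hba (potentialSE_pos hε t y).le
      _ ≤ ε * Real.exp (t / 2) * (y - x) := by
        rw [mul_comm]
        exact mul_le_mul_of_nonneg_right hFy (by linarith)

/-! ### Gradients of norm at most one -/

theorem IsSubgradient.norm_le_one {H : Type*} [NormedAddCommGroup H] [InnerProductSpace ℝ H]
    {f : H → ℝ} {x g : H} (hf : LipschitzWith 1 f)
    (hg : IsSubgradient f x g) : ‖g‖ ≤ 1 := by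
  have h := hg (x + g)
  have h2 := (le_abs_self _).trans (hf.dist_le_mul (x + g) x)
  rw [add_sub_cancel_left, real_inner_self_eq_norm_sq] at h
  rw [dist_eq_norm, add_sub_cancel_left, NNReal.coe_one, one_mul] at h2
  nlinarith [norm_nonneg g]

theorem norm_neg_sum_le {E : Type*} [SeminormedAddCommGroup E] {g : ℕ → E} (hg : ∀ t, ‖g t‖ ≤ 1)
    (t : ℕ) : ‖-∑ i ∈ Finset.range t, g i‖ ≤ t := by
  rw [norm_neg]
  refine (norm_sum_le _ _).trans ((Finset.sum_le_sum fun i _ => hg i).trans ?_)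
  simp

section Hilbert

variable {H : Type*} [NormedAddCommGroup H] [InnerProductSpace ℝ H]

/-! ### Radial maps -/

/-- A radial map whose profile is nonexpansive is nonexpansive: the angular part is contracted
because `p, q ≤ 1`. -/
theorem norm_smul_sub_smul_le {v w : H} {p q : ℝ} (hp0 : 0 ≤ p) (hp1 : p ≤ 1) (hq0 : 0 ≤ q)
    (hq1 : q ≤ 1) (h : |p * ‖v‖ - q * ‖w‖| ≤ |‖v‖ - ‖w‖|) : ‖p • v - q • w‖ ≤ ‖v - w‖ := by
  refine le_of_sq_le_sq ?_ (norm_nonneg _)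
  rw [norm_sub_sq_real, norm_sub_sq_real, norm_smul, norm_smul, real_inner_smul_left,
    real_inner_smul_right, Real.norm_of_nonneg hp0, Real.norm_of_nonneg hq0]
  have h1 := sq_le_sq.2 h
  have h2 : inner ℝ v w ≤ ‖v‖ * ‖w‖ := real_inner_le_norm v w
  have h3 : p * q ≤ 1 := mul_le_one₀ hp1 hq0 hq1
  nlinarith [mul_nonneg (sub_nonneg.2 h3) (sub_nonneg.2 h2)]

theorem exists_clip_eq_smul (t : ℕ) (v : H) :
    ∃ p : ℝ, 0 ≤ p ∧ p ≤ 1 ∧ p * ‖v‖ = min ‖v‖ t ∧ clip t v = p • v := by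
  by_cases h : ‖v‖ ≤ t
  · exact ⟨1, zero_le_one, le_rfl, by simp [h], by simp [clip, h]⟩
  · push Not at h
    have h0 : 0 < ‖v‖ := (Nat.cast_nonneg t).trans_lt h
    refine ⟨t / ‖v‖, by positivity, (div_le_one h0).2 h.le, ?_, by rw [clip, if_neg h.not_ge]⟩
    rw [div_mul_cancel₀ _ h0.ne', min_eq_right h.le]

theorem norm_clip_le (t : ℕ) (v : H) : ‖clip t v‖ ≤ t := by
  obtain ⟨p, hp0, -, h, e⟩ := exists_clip_eq_smul t v
  rw [e, norm_smul, Real.norm_of_nonneg hp0, h]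
  exact min_le_right _ _

theorem norm_clip_sub_clip_le (t : ℕ) (v w : H) : ‖clip t v - clip t w‖ ≤ ‖v - w‖ := by
  obtain ⟨p, hp0, hp1, hp, ep⟩ := exists_clip_eq_smul t v
  obtain ⟨q, hq0, hq1, hq, eq⟩ := exists_clip_eq_smul t w
  rw [ep, eq]
  refine norm_smul_sub_smul_le hp0 hp1 hq0 hq1 ?_
  rw [hp, hq]
  simpa using abs_min_sub_min_le_max ‖v‖ (t : ℝ) ‖w‖ t

theorem clip_of_norm_le {t : ℕ} {v : H} (h : ‖v‖ ≤ t) : clip t v = v := if_pos h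

/-! ### The coin-betting map -/

namespace IsBettingPotential

variable {F : ℕ → ℝ → ℝ} {ε A r : ℝ}

theorem fraction_zero (hF : IsBettingPotential F ε A r) (t : ℕ) : betFraction F t 0 = 0 := by
  rw [betFraction, zero_add, zero_sub, hF.even, sub_self, zero_div]

theorem pos_add_sub (hF : IsBettingPotential F ε A r) {t : ℕ} {x : ℝ} (hx : |x| ≤ t) :
    0 < F (t + 1) (x + 1) ∧ 0 < F (t + 1) (x - 1) := by
  have h := abs_le.1 hx
  constructor <;> refine hF.pos _ _ (abs_lt.2 ⟨?_, ?_⟩) <;> push_cast <;> linarith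

theorem abs_fraction_le_one (hF : IsBettingPotential F ε A r) {t : ℕ} {x : ℝ} (hx : |x| ≤ t) :
    |betFraction F (t + 1) x| ≤ 1 := by
  obtain ⟨h1, h2⟩ := hF.pos_add_sub hx
  rw [betFraction, abs_div, abs_of_pos (add_pos h1 h2), div_le_one (add_pos h1 h2), abs_le]
  constructor <;> linarith

theorem fraction_le_self (hF : IsBettingPotential F ε A r) {t : ℕ} {x : ℝ} (h0 : 0 ≤ x)
    (hx : x ≤ t) : betFraction F (t + 1) x ≤ x := by
  have := hF.fraction_lipschitz t 0 x le_rfl h0 hx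
  rw [hF.fraction_zero, sub_zero, sub_zero] at this
  exact (le_abs_self _).trans this

/-- The coin-betting map is the potential times a radial map with profile `β`. -/
theorem bet_eq (F : ℕ → ℝ → ℝ) (t : ℕ) (v : H) :
    bet F (t + 1) v = F t ‖v‖ • ((betFraction F (t + 1) ‖v‖ / ‖v‖) • v) := by
  rw [bet]
  split_ifs with h
  · simp [h]
  · rw [betFunction, Nat.add_sub_cancel, smul_smul]
    congr 1
    ring

theorem fraction_div_mem (hF : IsBettingPotential F ε A r) {t : ℕ} {x : ℝ} (h0 : 0 ≤ x)
    (hx : x ≤ t) : 0 ≤ betFraction F (t + 1) x / x ∧ betFraction F (t + 1) x / x ≤ 1 ∧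
      betFraction F (t + 1) x / x * x = betFraction F (t + 1) x := by
  refine ⟨div_nonneg (hF.fraction_nonneg t _ h0 hx) h0,
    div_le_one_of_le₀ (hF.fraction_le_self h0 hx) h0, ?_⟩
  rcases eq_or_ne x 0 with h | h
  · rw [h, hF.fraction_zero, mul_zero]
  · exact div_mul_cancel₀ _ h

theorem pos_of_le (hF : IsBettingPotential F ε A r) {t : ℕ} {x : ℝ} (h0 : 0 ≤ x) (hx : x ≤ t) :
    0 < F t x :=
  hF.pos t _ (by rw [abs_of_nonneg h0]; linarith)

theorem norm_radial_le_one (hF : IsBettingPotential F ε A r) {t : ℕ} {v : H} (hv : ‖v‖ ≤ t) :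
    ‖(betFraction F (t + 1) ‖v‖ / ‖v‖) • v‖ ≤ 1 := by
  obtain ⟨h0, -, h⟩ := hF.fraction_div_mem (norm_nonneg v) hv
  rw [norm_smul, Real.norm_of_nonneg h0, h]
  exact (le_abs_self _).trans (hF.abs_fraction_le_one (by rwa [abs_norm]))

theorem norm_bet_le (hF : IsBettingPotential F ε A r) {t : ℕ} {v : H} (hv : ‖v‖ ≤ t) :
    ‖bet F (t + 1) v‖ ≤ A * r ^ t := by
  obtain ⟨M, L, hL, hML, hM, -⟩ := hF.growth t
  have hpos := hF.pos_of_le (norm_nonneg v) hv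
  rw [bet_eq, norm_smul, Real.norm_of_nonneg hpos.le]
  have := mul_le_mul_of_nonneg_left (hF.norm_radial_le_one hv) hpos.le
  linarith [hM ‖v‖ (norm_nonneg v) hv]

theorem norm_bet_sub_bet_le (hF : IsBettingPotential F ε A r) {t : ℕ} {v w : H} (hv : ‖v‖ ≤ t)
    (hw : ‖w‖ ≤ t) : ‖bet F (t + 1) v - bet F (t + 1) w‖ ≤ A * r ^ t * ‖v - w‖ := by
  wlog hwv : ‖w‖ ≤ ‖v‖ generalizing v w
  · rw [norm_sub_rev, norm_sub_rev v]
    exact this hw hv (le_of_not_ge hwv)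
  obtain ⟨M, L, hL, hML, hM, hLip⟩ := hF.growth t
  obtain ⟨p0, p1, hp⟩ := hF.fraction_div_mem (norm_nonneg v) hv
  obtain ⟨q0, q1, hq⟩ := hF.fraction_div_mem (norm_nonneg w) hw
  have hB1 := hF.norm_radial_le_one hv
  have hB : ‖(betFraction F (t + 1) ‖v‖ / ‖v‖) • v - (betFraction F (t + 1) ‖w‖ / ‖w‖) • w‖ ≤
      ‖v - w‖ := by
    refine norm_smul_sub_smul_le p0 p1 q0 q1 ?_
    rw [hp, hq, abs_of_nonneg (sub_nonneg.2 hwv)]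
    exact hF.fraction_lipschitz t _ _ (norm_nonneg w) hwv hv
  rw [bet_eq, bet_eq]
  set B := (betFraction F (t + 1) ‖v‖ / ‖v‖) • v
  set B' := (betFraction F (t + 1) ‖w‖ / ‖w‖) • w
  have hmono : F t ‖w‖ ≤ F t ‖v‖ :=
    monotoneOn_Ico_of_comp_sqrt (hF.even t) (hF.monotoneOn_sqrt t)
      ⟨norm_nonneg w, by linarith⟩ ⟨norm_nonneg v, by linarith⟩ hwv
  have hpos := hF.pos_of_le (norm_nonneg w) hw
  have e : F t ‖v‖ • B - F t ‖w‖ • B' = (F t ‖v‖ - F t ‖w‖) • B + F t ‖w‖ • (B - B') := by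
    module
  have hd := norm_sub_norm_le v w
  calc ‖F t ‖v‖ • B - F t ‖w‖ • B'‖
      ≤ ‖(F t ‖v‖ - F t ‖w‖) • B‖ + ‖F t ‖w‖ • (B - B')‖ := e ▸ norm_add_le _ _
    _ = (F t ‖v‖ - F t ‖w‖) * ‖B‖ + F t ‖w‖ * ‖B - B'‖ := by
      rw [norm_smul (F t ‖v‖ - F t ‖w‖) B, norm_smul (F t ‖w‖) (B - B'),
        Real.norm_of_nonneg (sub_nonneg.2 hmono), Real.norm_of_nonneg hpos.le]
    _ ≤ (F t ‖v‖ - F t ‖w‖) * 1 + M * ‖v - w‖ :=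
      add_le_add (mul_le_mul_of_nonneg_left hB1 (sub_nonneg.2 hmono))
        (mul_le_mul (hM _ (norm_nonneg w) hw) hB (norm_nonneg _)
          (hpos.le.trans (hM _ (norm_nonneg w) hw)))
    _ ≤ L * ‖v - w‖ + M * ‖v - w‖ := by
      have := hLip _ _ (norm_nonneg w) hwv hv
      nlinarith
    _ ≤ A * r ^ t * ‖v - w‖ := by
      rw [← add_mul, add_comm]
      exact mul_le_mul_of_nonneg_right hML (norm_nonneg _)

theorem growth_nonneg (hF : IsBettingPotential F ε A r) (t : ℕ) : 0 ≤ A * r ^ t := by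
  obtain ⟨M, L, hL, hML, hM, -⟩ := hF.growth t
  have := hF.pos t 0 (by rw [abs_zero]; positivity)
  linarith [hM 0 le_rfl (by positivity)]

/-- The prediction map `Bet_{t+1} ∘ clip_t` is Lipschitz on the whole space. -/
theorem norm_bet_clip_sub_le (hF : IsBettingPotential F ε A r) (t : ℕ) (v w : H) :
    ‖bet F (t + 1) (clip t v) - bet F (t + 1) (clip t w)‖ ≤ A * r ^ t * ‖v - w‖ :=
  (hF.norm_bet_sub_bet_le (norm_clip_le t v) (norm_clip_le t w)).trans
    (mul_le_mul_of_nonneg_left (norm_clip_sub_clip_le t v w) (hF.growth_nonneg t))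

theorem continuous_bet_clip (hF : IsBettingPotential F ε A r) (t : ℕ) :
    Continuous fun v : H => bet F (t + 1) (clip t v) := by
  refine (LipschitzWith.of_dist_le_mul (K := ⟨A * r ^ t, hF.growth_nonneg t⟩)
    fun v w => ?_).continuous
  rw [dist_eq_norm, dist_eq_norm]
  exact hF.norm_bet_clip_sub_le t v w

/-! ### Growth of the wealth -/

/-- One round of scalar coin betting, extended from the outcomes `ρ = ±1` by convexity. -/
theorem potential_add_le (hF : IsBettingPotential F ε A r) {t : ℕ} {x ρ : ℝ} (hx : |x| ≤ t)
    (hρ : |ρ| ≤ 1) : F (t + 1) (x + ρ) ≤ F t x * (1 + ρ * betFraction F (t + 1) x) := by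
  obtain ⟨h1, h2⟩ := hF.pos_add_sub hx
  have hr := abs_le.1 hρ
  have ha := abs_le.1 hx
  have hc := (convexOn_Ioo_of_comp_sqrt (hF.even (t + 1)) (hF.convexOn_sqrt (t + 1))
    (hF.monotoneOn_sqrt (t + 1))).2
    (x := x + 1) (y := x - 1)
    ⟨by push_cast; linarith, by push_cast; linarith⟩
    ⟨by push_cast; linarith, by push_cast; linarith⟩
    (by linarith : 0 ≤ (1 + ρ) / 2) (by linarith : 0 ≤ (1 - ρ) / 2) (by ring)
  have hfair := hF.fair t x hx
  simp only [smul_eq_mul] at hc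
  have e : (1 + ρ) / 2 * (x + 1) + (1 - ρ) / 2 * (x - 1) = x + ρ := by ring
  rw [e] at hc
  refine hc.trans ?_
  have hb : betFraction F (t + 1) x * (F (t + 1) (x + 1) + F (t + 1) (x - 1)) =
      F (t + 1) (x + 1) - F (t + 1) (x - 1) := div_mul_cancel₀ _ (add_pos h1 h2).ne'
  have hnn : 0 ≤ 1 + ρ * betFraction F (t + 1) x := by
    have : |ρ * betFraction F (t + 1) x| ≤ 1 := by
      rw [abs_mul]
      exact mul_le_one₀ hρ (abs_nonneg _) (hF.abs_fraction_le_one hx)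
    linarith [(abs_le.1 this).1]
  have := mul_le_mul_of_nonneg_right hfair hnn
  linear_combination this / 2 - (ρ / 2) * hb

/-- One round of coin betting. As a function of `⟪c, v⟫` the left side is convex and the right side
affine, so the worst `c` is parallel to `v`, where the scalar inequality applies. -/
theorem potential_norm_add_le (hF : IsBettingPotential F ε A r) {t : ℕ} {v c : H} (hv : ‖v‖ ≤ t)
    (hc : ‖c‖ ≤ 1) : F (t + 1) ‖v + c‖ ≤ F t ‖v‖ + inner ℝ c (bet F (t + 1) v) := by
  have hx : |‖v‖| ≤ t := by rwa [abs_norm]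
  have hρ : |‖c‖| ≤ 1 := by rwa [abs_norm]
  rcases eq_or_ne v 0 with rfl | hv0
  · have := hF.potential_add_le (t := t) (x := 0) (ρ := ‖c‖) (by simp) hρ
    rw [hF.fraction_zero] at this
    simpa [bet] using this
  have hv1 : 0 < ‖v‖ := norm_pos_iff.2 hv0
  set i := inner ℝ c v with hi
  -- `z` is the cosine of the angle between `c` and `v`, and `0` if `c = 0`.
  set z := i / (‖c‖ * ‖v‖) with hz
  have hzi : z * (‖c‖ * ‖v‖) = i := by
    rcases eq_or_ne c 0 with rfl | h
    · simp [hi]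
    · exact div_mul_cancel₀ _ (mul_pos (norm_pos_iff.2 h) hv1).ne'
  have hz1 : |z| ≤ 1 := by
    rw [hz, abs_div, abs_of_nonneg (by positivity : 0 ≤ ‖c‖ * ‖v‖)]
    exact div_le_one_of_le₀ (abs_real_inner_le_norm c v) (by positivity)
  have hz2 := abs_le.1 hz1
  have hsq : ‖v + c‖ ^ 2 = (1 + z) / 2 * (‖v‖ + ‖c‖) ^ 2 + (1 - z) / 2 * (‖v‖ - ‖c‖) ^ 2 := by
    rw [norm_add_sq_real, real_inner_comm]
    linear_combination (-2) * hzi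
  have hmem : ∀ y : ℝ, |y| ≤ t + 1 → y ^ 2 ∈ Set.Ico 0 ((((t + 1 : ℕ) : ℝ) + 1) ^ 2) := by
    intro y hy
    refine ⟨sq_nonneg y, ?_⟩
    push_cast
    have := abs_le.1 hy
    nlinarith
  have hconv := (hF.convexOn_sqrt (t + 1)).2 (hmem (‖v‖ + ‖c‖) (by
      rw [abs_of_nonneg (by positivity)]; linarith)) (hmem (‖v‖ - ‖c‖) (by
      rw [abs_le]; constructor <;> linarith [norm_nonneg c]))
    (by linarith : 0 ≤ (1 + z) / 2) (by linarith : 0 ≤ (1 - z) / 2) (by ring)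
  simp only [smul_eq_mul] at hconv
  rw [← hsq, ← eq_comp_sqrt_sq_of_even (hF.even _), ← eq_comp_sqrt_sq_of_even (hF.even _),
    ← eq_comp_sqrt_sq_of_even (hF.even _)] at hconv
  have h1 := hF.potential_add_le hx hρ
  have h2 := hF.potential_add_le (ρ := -‖c‖) hx (by rwa [abs_neg])
  rw [← sub_eq_add_neg] at h2
  have e : inner ℝ c (bet F (t + 1) v) = F t ‖v‖ * betFraction F (t + 1) ‖v‖ * (z * ‖c‖) := by
    rw [bet_eq, smul_smul, real_inner_smul_right, ← hi, ← hzi]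
    field_simp
  rw [e]
  refine hconv.trans ?_
  have := add_le_add (mul_le_mul_of_nonneg_left h1 (by linarith : 0 ≤ (1 + z) / 2))
    (mul_le_mul_of_nonneg_left h2 (by linarith : 0 ≤ (1 - z) / 2))
  refine this.trans (le_of_eq ?_)
  ring

theorem potential_norm_neg_sum_le (hF : IsBettingPotential F ε A r) {g : ℕ → H}
    (hg : ∀ t, ‖g t‖ ≤ 1) (T : ℕ) :
    F T ‖-∑ i ∈ Finset.range T, g i‖ ≤
      ε - ∑ t ∈ Finset.range T, inner ℝ (g t) (bet F (t + 1) (-∑ i ∈ Finset.range t, g i)) := by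
  induction T with
  | zero => simp [hF.zero]
  | succ T ih =>
    have := hF.potential_norm_add_le (c := -g T) (norm_neg_sum_le hg T) (by
      rw [norm_neg]; exact hg T)
    rw [← neg_add, ← Finset.sum_range_succ, inner_neg_left] at this
    rw [Finset.sum_range_succ (fun t => inner ℝ (g t) _)]
    linarith

theorem bddAbove_conjugate (hF : IsBettingPotential F ε A r) (T : ℕ) (θ : ℝ) :
    BddAbove ((fun s : ℝ => θ * s - F T s) '' Set.Icc 0 (T : ℝ)) := by
  refine ⟨|θ| * T, ?_⟩
  rintro _ ⟨s, hs, rfl⟩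
  have := hF.pos T s (by rw [abs_of_nonneg hs.1]; linarith [hs.2])
  have h2 : θ * s ≤ |θ| * T :=
    mul_le_mul (le_abs_self θ) hs.2 hs.1 (abs_nonneg θ)
  change θ * s - F T s ≤ _
  linarith

/-- The regret of the centralized coin-betting algorithm on linear losses. -/
theorem sum_inner_bet_sub_le (hF : IsBettingPotential F ε A r) {g : ℕ → H}
    (hg : ∀ t, ‖g t‖ ≤ 1) (T : ℕ) (u : H) :
    ∑ t ∈ Finset.range T, inner ℝ (g t) (bet F (t + 1) (-∑ i ∈ Finset.range t, g i) - u) ≤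
      conjugate F T ‖u‖ + ε := by
  have h1 := hF.potential_norm_neg_sum_le hg T
  have h2 : ‖u‖ * ‖-∑ i ∈ Finset.range T, g i‖ - F T ‖-∑ i ∈ Finset.range T, g i‖ ≤
      conjugate F T ‖u‖ :=
    le_csSup (hF.bddAbove_conjugate T ‖u‖) ⟨_, ⟨norm_nonneg _, norm_neg_sum_le hg T⟩, rfl⟩
  have h3 := real_inner_le_norm (-∑ i ∈ Finset.range T, g i) u
  have h4 : ∑ t ∈ Finset.range T, inner ℝ (g t) (bet F (t + 1) (-∑ i ∈ Finset.range t, g i) - u) =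
      ∑ t ∈ Finset.range T, inner ℝ (g t) (bet F (t + 1) (-∑ i ∈ Finset.range t, g i)) +
        inner ℝ (-∑ i ∈ Finset.range T, g i) u := by
    simp only [inner_sub_right, Finset.sum_sub_distrib, inner_neg_left, sum_inner]
    ring
  rw [h4]
  nlinarith

end IsBettingPotential

end Hilbert

section Hilbert

variable {H : Type*} [NormedAddCommGroup H] [InnerProductSpace ℝ H] {N : ℕ}

/-! ### Gossip matrices acting on vectors of agents -/

/-- The `ℓ²` norm of a family of vectors indexed by the agents. -/
noncomputable def l2norm {E : Type*} [SeminormedAddCommGroup E] (z : Fin N → E) : ℝ :=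
  ‖(WithLp.toLp 2 z : PiLp 2 fun _ : Fin N => E)‖

/-- The action of a real matrix on a family of vectors. -/
def mix {E : Type*} [AddCommGroup E] [Module ℝ E] (W : Matrix (Fin N) (Fin N) ℝ) (z : Fin N → E) :
    Fin N → E :=
  fun n => ∑ j, W n j • z j

section Norm

variable {E : Type*} [SeminormedAddCommGroup E]

theorem l2norm_nonneg (z : Fin N → E) : 0 ≤ l2norm z := norm_nonneg _

theorem l2norm_sq (z : Fin N → E) : l2norm z ^ 2 = ∑ n, ‖z n‖ ^ 2 :=
  PiLp.norm_sq_eq_of_L2 (fun _ : Fin N => E) _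

theorem l2norm_add_le (z w : Fin N → E) : l2norm (z + w) ≤ l2norm z + l2norm w := by
  simpa [l2norm, WithLp.toLp_add] using norm_add_le (WithLp.toLp 2 z : PiLp 2 fun _ : Fin N => E)
    (WithLp.toLp 2 w)

theorem l2norm_neg (z : Fin N → E) : l2norm (-z) = l2norm z := by
  simp [l2norm, WithLp.toLp_neg]

theorem l2norm_sub_le (z w : Fin N → E) : l2norm (z - w) ≤ l2norm z + l2norm w := by
  rw [sub_eq_add_neg, ← l2norm_neg w]
  exact l2norm_add_le _ _

theorem l2norm_smul [NormedSpace ℝ E] {c : ℝ} (hc : 0 ≤ c) (z : Fin N → E) :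
    l2norm (c • z) = c * l2norm z := by
  rw [l2norm, WithLp.toLp_smul, norm_smul, Real.norm_of_nonneg hc, l2norm]

theorem norm_le_l2norm (z : Fin N → E) (n : Fin N) : ‖z n‖ ≤ l2norm z :=
  PiLp.norm_apply_le (WithLp.toLp 2 z : PiLp 2 fun _ : Fin N => E) n

theorem l2norm_le_of_norm_le {z : Fin N → E} {b : ℝ} (hb : 0 ≤ b) (h : ∀ n, ‖z n‖ ≤ b) :
    l2norm z ≤ b * √N := by
  refine le_of_sq_le_sq ?_ (by positivity)
  rw [l2norm_sq, mul_pow, Real.sq_sqrt (by positivity)]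
  calc ∑ n, ‖z n‖ ^ 2 ≤ ∑ _n : Fin N, b ^ 2 :=
        Finset.sum_le_sum fun n _ => pow_le_pow_left₀ (norm_nonneg _) (h n) 2
    _ = b ^ 2 * N := by simp [mul_comm]

end Norm

theorem mix_sub (W : Matrix (Fin N) (Fin N) ℝ) (z w : Fin N → H) :
    mix W (z - w) = mix W z - mix W w := by
  ext n
  simp [mix, smul_sub, Finset.sum_sub_distrib]

namespace IsGossipMatrix

variable {G : SimpleGraph (Fin N)} {W : Matrix (Fin N) (Fin N) ℝ}

theorem mix_const (hW : IsGossipMatrix G W) (x : H) : mix W (fun _ => x) = fun _ => x := by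
  ext n
  rw [mix, ← Finset.sum_smul, hW.row_sum, one_smul]

theorem sum_mix (hW : IsGossipMatrix G W) (z : Fin N → H) : ∑ n, mix W z n = ∑ n, z n := by
  simp only [mix]
  rw [Finset.sum_comm]
  simp [← Finset.sum_smul, hW.col_sum]

/-- Averaging with `W` decreases the squared norm by a weighted sum of squared differences. -/
theorem sum_sum_mul_norm_sub_mix_sq (hW : IsGossipMatrix G W) (z : Fin N → H) :
    ∑ i, ∑ j, W i j * ‖z j - mix W z i‖ ^ 2 = l2norm z ^ 2 - l2norm (mix W z) ^ 2 := by
  have h1 : ∀ i, ∑ j, W i j * ‖z j - mix W z i‖ ^ 2 =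
      ∑ j, W i j * ‖z j‖ ^ 2 - ‖mix W z i‖ ^ 2 := by
    intro i
    have h2 : ∑ j, W i j * inner ℝ (z j) (mix W z i) = ‖mix W z i‖ ^ 2 := by
      rw [← real_inner_self_eq_norm_sq]
      conv_rhs => rw [mix, sum_inner]
      simp only [real_inner_smul_left]
      rfl
    have h3 : ∑ j, W i j * ‖mix W z i‖ ^ 2 = ‖mix W z i‖ ^ 2 := by
      rw [← Finset.sum_mul, hW.row_sum, one_mul]
    calc ∑ j, W i j * ‖z j - mix W z i‖ ^ 2
        = ∑ j, (W i j * ‖z j‖ ^ 2 - 2 * (W i j * inner ℝ (z j) (mix W z i)) +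
          W i j * ‖mix W z i‖ ^ 2) :=
          Finset.sum_congr rfl fun j _ => by rw [norm_sub_sq_real]; ring
      _ = _ := by
        rw [Finset.sum_add_distrib, Finset.sum_sub_distrib, ← Finset.mul_sum, h2, h3]
        ring
  rw [Finset.sum_congr rfl fun i _ => h1 i, Finset.sum_sub_distrib, l2norm_sq, l2norm_sq,
    Finset.sum_comm]
  simp [← Finset.sum_mul, hW.col_sum]

theorem l2norm_mix_le (hW : IsGossipMatrix G W) (z : Fin N → H) :
    l2norm (mix W z) ≤ l2norm z := by
  refine le_of_sq_le_sq ?_ (l2norm_nonneg z)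
  have := hW.sum_sum_mul_norm_sub_mix_sq z
  have h0 : 0 ≤ ∑ i, ∑ j, W i j * ‖z j - mix W z i‖ ^ 2 :=
    Finset.sum_nonneg fun i _ => Finset.sum_nonneg fun j _ =>
      mul_nonneg (hW.nonneg i j) (sq_nonneg _)
  linarith

/-- On a connected graph only constant families keep their norm. -/
theorem l2norm_mix_lt (hG : G.Connected) (hW : IsGossipMatrix G W) {z : Fin N → H} (hz : z ≠ 0)
    (hsum : ∑ n, z n = 0) : l2norm (mix W z) < l2norm z := by
  refine lt_of_le_of_ne (hW.l2norm_mix_le z) fun heq => hz ?_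
  have h := hW.sum_sum_mul_norm_sub_mix_sq z
  rw [heq, sub_self, Finset.sum_eq_zero_iff_of_nonneg fun i _ => Finset.sum_nonneg fun j _ =>
    mul_nonneg (hW.nonneg i j) (sq_nonneg _)] at h
  have hz' : ∀ i j, 0 < W i j → z j = mix W z i := by
    intro i j hij
    have := h i (Finset.mem_univ i)
    rw [Finset.sum_eq_zero_iff_of_nonneg fun j _ =>
      mul_nonneg (hW.nonneg i j) (sq_nonneg _)] at this
    have := (mul_eq_zero.1 (this j (Finset.mem_univ j))).resolve_left hij.ne'
    exact sub_eq_zero.1 (norm_eq_zero.1 (pow_eq_zero_iff two_ne_zero |>.1 this))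
  have hadj : ∀ i j, G.Adj i j → z i = z j := fun i j hij => by
    rw [hz' i i (hW.diag_pos i), hz' i j (hW.pos_of_adj i j hij)]
  have hconst : ∀ i j, z i = z j := by
    intro i j
    obtain ⟨p⟩ := hG.preconnected i j
    induction p with
    | nil => rfl
    | cons h _ ih => exact (hadj _ _ h).trans ih
  funext i
  have hN : (N : ℝ) ≠ 0 := by
    have := i.pos
    positivity
  rw [Finset.sum_congr rfl fun n _ => hconst n i, Finset.sum_const, Finset.card_univ,
    Fintype.card_fin, ← Nat.cast_smul_eq_nsmul ℝ] at hsum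
  exact (smul_eq_zero.1 hsum).resolve_left hN

theorem exists_isContractionFactor (hG : G.Connected) (hW : IsGossipMatrix G W) :
    ∃ ρ : ℝ, IsContractionFactor W ρ := by
  set K : Set (EuclideanSpace ℝ (Fin N)) := Metric.sphere 0 1 ∩ {z | ∑ n, z n = 0} with hK
  have hcont : Continuous fun z : EuclideanSpace ℝ (Fin N) =>
      ‖(WithLp.toLp 2 (W.mulVec z.ofLp) : EuclideanSpace ℝ (Fin N))‖ := by
    refine continuous_norm.comp ((PiLp.continuous_toLp 2 _).comp ?_)
    exact Continuous.matrix_mulVec continuous_const (PiLp.continuous_ofLp 2 _)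
  have hcomp : IsCompact K := by
    refine (isCompact_sphere _ _).inter_right (isClosed_eq ?_ continuous_const)
    fun_prop
  have hnormalize : ∀ z : Fin N → ℝ, z ≠ 0 → ∑ n, z n = 0 →
      (WithLp.toLp 2 ((l2norm z)⁻¹ • z) : EuclideanSpace ℝ (Fin N)) ∈ K := by
    intro z hz hsum
    have hpos : 0 < l2norm z := norm_pos_iff.2 (by simpa using hz)
    refine ⟨?_, ?_⟩
    · rw [mem_sphere_zero_iff_norm]
      change l2norm ((l2norm z)⁻¹ • z) = 1
      rw [l2norm_smul (by positivity), inv_mul_cancel₀ hpos.ne']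
    · simp [← Finset.mul_sum, hsum]
  rcases K.eq_empty_or_nonempty with he | hne
  · refine ⟨0, le_rfl, zero_lt_one, fun z hsum => ?_⟩
    have hz : z = 0 := by
      by_contra hz
      have := hnormalize z hz hsum
      rw [he] at this
      exact this
    simp [hz]
  · obtain ⟨z₀, ⟨hz₀, hsum₀⟩, hmax⟩ := hcomp.exists_isMaxOn hne hcont.continuousOn
    rw [mem_sphere_zero_iff_norm] at hz₀
    refine ⟨‖(WithLp.toLp 2 (W.mulVec z₀.ofLp) : EuclideanSpace ℝ (Fin N))‖, norm_nonneg _, ?_,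
      fun z hsum => ?_⟩
    · refine (l2norm_mix_lt hG hW (z := z₀.ofLp) (fun h => ?_) hsum₀).trans_eq hz₀
      have : z₀ = 0 := by
        ext i
        exact congrFun h i
      rw [this, norm_zero] at hz₀
      exact zero_ne_one hz₀
    · rcases eq_or_ne z 0 with rfl | hz
      · simp
      · have hpos : 0 < l2norm z := norm_pos_iff.2 (by simpa using hz)
        have h := hmax (hnormalize z hz hsum)
        have h' : l2norm (W.mulVec ((l2norm z)⁻¹ • z)) ≤
            ‖(WithLp.toLp 2 (W.mulVec z₀.ofLp) : EuclideanSpace ℝ (Fin N))‖ := h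
        rw [Matrix.mulVec_smul, l2norm_smul (by positivity), inv_mul_le_iff₀ hpos, mul_comm] at h'
        exact h'

end IsGossipMatrix

/-- A contraction factor for real vectors also works for vectors in a Hilbert space: expand in an
orthonormal basis of the span of the entries. -/
theorem IsContractionFactor.l2norm_mix_le {W : Matrix (Fin N) (Fin N) ℝ} {ρ : ℝ}
    (hρ : IsContractionFactor W ρ) {z : Fin N → H} (hz : ∑ n, z n = 0) :
    l2norm (mix W z) ≤ ρ * l2norm z := by
  set K := Submodule.span ℝ (Set.range z)
  have : FiniteDimensional ℝ K := FiniteDimensional.span_of_finite ℝ (Set.finite_range z)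
  let b := stdOrthonormalBasis ℝ K
  have hzK : ∀ n, z n ∈ K := fun n => Submodule.subset_span ⟨n, rfl⟩
  have hsq : ∀ w : Fin N → H, (∀ n, w n ∈ K) →
      l2norm w ^ 2 = ∑ k, l2norm (fun n => inner ℝ (b k : H) (w n)) ^ 2 := by
    intro w hw
    simp only [l2norm_sq]
    rw [Finset.sum_comm]
    exact Finset.sum_congr rfl fun n _ => (b.sum_sq_norm_inner_right ⟨w n, hw n⟩).symm
  have hmem : ∀ n, mix W z n ∈ K := fun n =>
    Submodule.sum_mem _ fun j _ => Submodule.smul_mem _ _ (hzK j)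
  refine le_of_sq_le_sq ?_ (mul_nonneg hρ.nonneg (l2norm_nonneg z))
  rw [mul_pow, hsq z hzK, hsq _ hmem, Finset.mul_sum]
  refine Finset.sum_le_sum fun k _ => ?_
  rw [← mul_pow]
  refine pow_le_pow_left₀ (l2norm_nonneg _) ?_ 2
  have h := hρ.contracts (fun n => inner ℝ (b k : H) (z n))
    (by rw [← inner_sum, hz, inner_zero_right])
  have e : (fun n => inner ℝ (b k : H) (mix W z n)) =
      W.mulVec fun n => inner ℝ (b k : H) (z n) := by
    funext n
    simp [mix, Matrix.mulVec, dotProduct, inner_sum, real_inner_smul_right]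
  rw [e]
  exact h

end Hilbert

section Hilbert

variable {H : Type*} [NormedAddCommGroup H] [InnerProductSpace ℝ H] {N : ℕ}

/-! ### One compressed gossip substep -/

/-- The network average of a family of vectors. -/
noncomputable def average (z : Fin N → H) : H := (N : ℝ)⁻¹ • ∑ n, z n

/-- The deviation of a family of vectors from its network average. -/
noncomputable def deviation (z : Fin N → H) : Fin N → H := z - fun _ => average z

theorem average_add (z w : Fin N → H) : average (z + w) = average z + average w := by
  simp [average, Finset.sum_add_distrib]

theorem average_neg (z : Fin N → H) : average (-z) = -average z := by
  simp [average, Finset.sum_neg_distrib]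

theorem deviation_add (z w : Fin N → H) : deviation (z + w) = deviation z + deviation w := by
  ext n
  simp only [deviation, average_add, Pi.sub_apply, Pi.add_apply]
  abel

theorem norm_average_le {z : Fin N → H} {b : ℝ} (hb : 0 ≤ b) (h : ∀ n, ‖z n‖ ≤ b) :
    ‖average z‖ ≤ b := by
  rw [average, norm_smul, norm_inv, Real.norm_natCast]
  rcases N.eq_zero_or_pos with rfl | hN
  · simpa using hb
  have hN' : (0 : ℝ) < N := by exact_mod_cast hN
  rw [inv_mul_le_iff₀ hN']
  refine (norm_sum_le _ _).trans ((Finset.sum_le_sum fun n _ => h n).trans (le_of_eq ?_))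
  simp

theorem sum_deviation (z : Fin N → H) : ∑ n, deviation z n = 0 := by
  rcases N.eq_zero_or_pos with rfl | hN
  · simp
  have hN' : (N : ℝ) ≠ 0 := by positivity
  simp only [deviation, Pi.sub_apply, Finset.sum_sub_distrib, Finset.sum_const, Finset.card_univ,
    Fintype.card_fin, ← Nat.cast_smul_eq_nsmul ℝ, average]
  rw [smul_inv_smul₀ hN', sub_self]

namespace IsGossipMatrix

variable {G : SimpleGraph (Fin N)} {W : Matrix (Fin N) (Fin N) ℝ}

theorem mix_deviation_sub (hW : IsGossipMatrix G W) (z : Fin N → H) :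
    mix W (deviation z) - deviation z = mix W z - z := by
  rw [deviation, mix_sub, hW.mix_const]
  abel

theorem average_mix_sub (hW : IsGossipMatrix G W) (z : Fin N → H) :
    average (mix W z - z) = 0 := by
  simp [average, Finset.sum_sub_distrib, hW.sum_mix]

variable {Ω : Type*} (C : Ω → H → H) (γ : ℝ) (ω : Fin N → Ω)
  (p : (Fin N → H) × (Fin N → H))

theorem gossipStep_fst (hW : IsGossipMatrix G W) :
    (gossipStep C W γ ω p).1 = p.1 + γ • (mix W (gossipStep C W γ ω p).2 -
      (gossipStep C W γ ω p).2) := by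
  ext n
  simp only [gossipStep, mix, Pi.add_apply, Pi.smul_apply, Pi.sub_apply, smul_sub,
    Finset.sum_sub_distrib, ← Finset.sum_smul, hW.row_sum, one_smul]

theorem average_gossipStep (hW : IsGossipMatrix G W) :
    average (gossipStep C W γ ω p).1 = average p.1 := by
  rw [hW.gossipStep_fst, average_add]
  have : average (γ • (mix W (gossipStep C W γ ω p).2 - (gossipStep C W γ ω p).2)) =
      γ • average (mix W (gossipStep C W γ ω p).2 - (gossipStep C W γ ω p).2) := by
    simp [average, ← Finset.smul_sum, smul_comm γ]
  rw [this, hW.average_mix_sub, smul_zero, add_zero]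

/-- Gossip preserves the network average, which is therefore the negative sum of the averaged
gradients. -/
theorem average_state (hW : IsGossipMatrix G W) (q : ℕ → ℕ) (ω : ℕ → ℕ → Fin N → Ω)
    (g : ℕ → Fin N → H) (t : ℕ) :
    average (state C W γ q ω g t).1 = -∑ i ∈ Finset.range t, average (g i) := by
  have hgossip : ∀ (ω : ℕ → Fin N → Ω) (p : (Fin N → H) × (Fin N → H)) (k : ℕ),
      average (gossip C W γ ω p k).1 = average p.1 := by
    intro ω p k
    induction k with
    | zero => rfl
    | succ k ih => exact (hW.average_gossipStep C γ (ω k) _).trans ih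
  induction t with
  | zero => simp [state, average]
  | succ t ih =>
    have e : (fun n => (state C W γ q ω g t).1 n + -g t n) = (state C W γ q ω g t).1 + -g t := rfl
    rw [state, hgossip, Finset.sum_range_succ, e, average_add, average_neg, ih, neg_add]

theorem l2norm_mix_sub_le (hW : IsGossipMatrix G W) (z : Fin N → H) :
    l2norm (mix W z - z) ≤ 2 * l2norm z := by
  linarith [l2norm_sub_le (mix W z) z, hW.l2norm_mix_le z]

/-- The clean states contract towards their average, up to the compression error. -/
theorem l2norm_deviation_gossipStep_le (hW : IsGossipMatrix G W) {ρ : ℝ}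
    (hρ : IsContractionFactor W ρ) (h0 : 0 ≤ γ) (h1 : γ ≤ 1) :
    l2norm (deviation (gossipStep C W γ ω p).1) ≤
      (1 - γ * (1 - ρ)) * l2norm (deviation p.1) +
        2 * γ * l2norm ((gossipStep C W γ ω p).2 - p.1) := by
  set Y := deviation p.1 with hY
  set e := (gossipStep C W γ ω p).2 - p.1 with he
  have hdev : deviation (gossipStep C W γ ω p).1 =
      (1 - γ) • Y + γ • mix W Y + γ • (mix W e - e) := by
    have h2 := hW.mix_deviation_sub p.1
    have h3 : mix W Y = mix W p.1 - p.1 + Y := by rw [← h2]; abel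
    rw [deviation, hW.average_gossipStep, hW.gossipStep_fst, h3, he, mix_sub, hY, deviation]
    module
  rw [hdev]
  have hm := hρ.l2norm_mix_le (sum_deviation p.1)
  have he2 := hW.l2norm_mix_sub_le e
  calc l2norm ((1 - γ) • Y + γ • mix W Y + γ • (mix W e - e))
      ≤ l2norm ((1 - γ) • Y) + l2norm (γ • mix W Y) + l2norm (γ • (mix W e - e)) :=
        (l2norm_add_le _ _).trans (add_le_add (l2norm_add_le _ _) le_rfl)
    _ = (1 - γ) * l2norm Y + γ * l2norm (mix W Y) + γ * l2norm (mix W e - e) := by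
      rw [l2norm_smul (sub_nonneg.2 h1), l2norm_smul h0, l2norm_smul h0]
    _ ≤ (1 - γ) * l2norm Y + γ * (ρ * l2norm Y) + γ * (2 * l2norm e) := by gcongr
    _ = _ := by ring

/-- The trackers follow the clean states, up to the compression error and the disagreement. -/
theorem l2norm_gossipStep_fst_sub_snd_le (hW : IsGossipMatrix G W) (h0 : 0 ≤ γ) :
    l2norm ((gossipStep C W γ ω p).1 - (gossipStep C W γ ω p).2) ≤
      2 * γ * l2norm (deviation p.1) +
        (1 + 2 * γ) * l2norm ((gossipStep C W γ ω p).2 - p.1) := by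
  set Y := deviation p.1 with hY
  set e := (gossipStep C W γ ω p).2 - p.1 with he
  have hdiff : (gossipStep C W γ ω p).1 - (gossipStep C W γ ω p).2 =
      -e + γ • (mix W Y - Y) + γ • (mix W e - e) := by
    rw [hW.gossipStep_fst, hW.mix_deviation_sub, he, mix_sub]
    module
  rw [hdiff]
  calc l2norm (-e + γ • (mix W Y - Y) + γ • (mix W e - e))
      ≤ l2norm (-e) + l2norm (γ • (mix W Y - Y)) + l2norm (γ • (mix W e - e)) :=
        (l2norm_add_le _ _).trans (add_le_add (l2norm_add_le _ _) le_rfl)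
    _ = l2norm e + γ * l2norm (mix W Y - Y) + γ * l2norm (mix W e - e) := by
      rw [l2norm_neg, l2norm_smul h0, l2norm_smul h0]
    _ ≤ l2norm e + γ * (2 * l2norm Y) + γ * (2 * l2norm e) := by
      gcongr <;> exact hW.l2norm_mix_sub_le _
    _ = _ := by ring

end IsGossipMatrix

end Hilbert

/-! ### Mean-square estimates -/

section Probability

variable {H : Type*} [NormedAddCommGroup H] {N : ℕ}

theorem measurable_l2norm {S : Type*} [MeasurableSpace S] {z : S → Fin N → H}
    (hz : ∀ n, StronglyMeasurable fun s => z s n) :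
    Measurable fun s => l2norm (z s) := by
  have e : (fun s => l2norm (z s)) = fun s => √(∑ n, ‖z s n‖ ^ 2) := by
    funext s
    rw [← l2norm_sq, Real.sqrt_sq (l2norm_nonneg _)]
  rw [e]
  exact (Finset.measurable_sum _ fun n _ => ((hz n).norm.measurable.pow_const 2)).sqrt

theorem enorm_l2norm_sq (z : Fin N → H) : ‖l2norm z‖ₑ ^ 2 = ∑ n, ‖z n‖ₑ ^ 2 := by
  rw [Real.enorm_of_nonneg (l2norm_nonneg z), ← ENNReal.ofReal_pow (l2norm_nonneg z), l2norm_sq,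
    ENNReal.ofReal_sum_of_nonneg fun n _ => sq_nonneg _]
  refine Finset.sum_congr rfl fun n _ => ?_
  rw [ENNReal.ofReal_pow (norm_nonneg _), ofReal_norm]

variable [MeasurableSpace H] [BorelSpace H] {Ω S : Type*} [MeasurableSpace Ω] [MeasurableSpace S]
  {P : Measure Ω} {Q : Measure S} {C : Ω → H → H} {α : ℝ}

theorem IsCompressor.stronglyMeasurable_comp (hC : IsCompressor P C α) {ω : S → Ω} {v : S → H}
    (hω : Measurable ω) (hv : StronglyMeasurable v) :
    StronglyMeasurable fun s => C (ω s) (v s) :=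
  (hC.measurable _ hv.isSeparable_range).comp_measurable
    (g := fun s => (ω s, (⟨v s, s, rfl⟩ : Set.range v)))
    (hω.prodMk (hv.measurable.subtype_mk))

/-- A fresh draw has the mean-square residual of the compressor also on a random input. -/
theorem IsCompressor.lintegral_residual_le [IsProbabilityMeasure P] [IsProbabilityMeasure Q]
    (hC : IsCompressor P C α) {ω : S → Ω} {v : S → H}
    (hω : MeasurePreserving ω Q P) (hv : StronglyMeasurable v) (hind : IndepFun ω v Q) :
    ∫⁻ s, ‖C (ω s) (v s) - v s‖ₑ ^ 2 ∂Q ≤ ENNReal.ofReal α * ∫⁻ s, ‖v s‖ₑ ^ 2 ∂Q := by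
  let w : S → Set.range v := fun s => ⟨v s, s, rfl⟩
  have hw : Measurable w := hv.measurable.subtype_mk
  have hindw : IndepFun ω w Q := by
    rw [IndepFun_iff_Indep] at hind ⊢
    have : MeasurableSpace.comap w inferInstance = MeasurableSpace.comap v inferInstance := by
      rw [show (inferInstance : MeasurableSpace (Set.range v)) =
        MeasurableSpace.comap Subtype.val inferInstance from rfl, MeasurableSpace.comap_comp]
      rfl
    rwa [this]
  have hmap := (indepFun_iff_map_prod_eq_prod_map_map hω.measurable.aemeasurable
    hw.aemeasurable).1 hindw
  rw [hω.map_eq] at hmap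
  have hval : StronglyMeasurable fun p : Ω × Set.range v => (p.2 : H) := by
    refine stronglyMeasurable_iff_measurable_separable.2
      ⟨measurable_subtype_coe.comp measurable_snd, hv.isSeparable_range.mono ?_⟩
    rintro _ ⟨p, rfl⟩
    exact p.2.2
  have hmeas : Measurable fun p : Ω × Set.range v => ‖C p.1 (p.2 : H) - p.2‖ₑ ^ 2 :=
    ((hC.measurable _ hv.isSeparable_range).sub hval).enorm.pow_const 2
  calc ∫⁻ s, ‖C (ω s) (v s) - v s‖ₑ ^ 2 ∂Q
      = ∫⁻ p, ‖C p.1 (p.2 : H) - p.2‖ₑ ^ 2 ∂(Q.map fun s => (ω s, w s)) :=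
        (lintegral_map hmeas (hω.measurable.prodMk hw)).symm
    _ = ∫⁻ x, ∫⁻ o, ‖C o (x : H) - x‖ₑ ^ 2 ∂P ∂(Q.map w) := by
      have : IsProbabilityMeasure (Q.map w) := Measure.isProbabilityMeasure_map hw.aemeasurable
      rw [hmap, lintegral_prod_symm' _ hmeas]
    _ ≤ ∫⁻ x, ENNReal.ofReal (α * ‖(x : H)‖ ^ 2) ∂(Q.map w) :=
      lintegral_mono fun x => hC.residual x
    _ = ∫⁻ x, ENNReal.ofReal α * ‖(x : H)‖ₑ ^ 2 ∂(Q.map w) := by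
      refine lintegral_congr fun x => ?_
      rw [ENNReal.ofReal_mul hC.nonneg, ENNReal.ofReal_pow (norm_nonneg _), ofReal_norm]
    _ = ∫⁻ s, ENNReal.ofReal α * ‖v s‖ₑ ^ 2 ∂Q :=
      lintegral_map ((measurable_subtype_coe.enorm.pow_const 2).const_mul _) hw
    _ = _ := lintegral_const_mul _ (hv.enorm.pow_const 2)

theorem eLpNorm_two_sq (f : S → ℝ) : eLpNorm f 2 Q ^ 2 = ∫⁻ s, ‖f s‖ₑ ^ 2 ∂Q := by
  have h := eLpNorm_nnreal_pow_eq_lintegral (μ := Q) (f := f) (p := 2) two_ne_zero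
  simp only [ENNReal.coe_ofNat, NNReal.coe_ofNat, ENNReal.rpow_ofNat] at h
  exact h

theorem IsCompressor.eLpNorm_residual_le [IsProbabilityMeasure P] [IsProbabilityMeasure Q]
    (hC : IsCompressor P C α) {ω : Fin N → S → Ω} {v : S → Fin N → H}
    (hω : ∀ n, MeasurePreserving (ω n) Q P) (hv : ∀ n, StronglyMeasurable fun s => v s n)
    (hind : ∀ n, IndepFun (ω n) v Q) :
    eLpNorm (fun s => l2norm fun n => C (ω n s) (v s n) - v s n) 2 Q ≤
      ENNReal.ofReal √α * eLpNorm (fun s => l2norm (v s)) 2 Q := by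
  rw [← ENNReal.pow_le_pow_left_iff (two_ne_zero), mul_pow, eLpNorm_two_sq, eLpNorm_two_sq,
    ← ENNReal.ofReal_pow (Real.sqrt_nonneg α), Real.sq_sqrt hC.nonneg]
  simp only [enorm_l2norm_sq]
  rw [lintegral_finsetSum _ fun n _ => ?_, lintegral_finsetSum _ fun n _ => ?_, Finset.mul_sum]
  · exact Finset.sum_le_sum fun n _ => hC.lintegral_residual_le (hω n) (hv n)
      ((hind n).comp measurable_id (measurable_pi_apply n))
  · exact (hv n).enorm.pow_const 2
  · exact ((hC.stronglyMeasurable_comp (hω n).measurable (hv n)).sub (hv n)).enorm.pow_const 2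

theorem eLpNorm_le_of_le_add {f g h : S → ℝ} {a b : ℝ} (ha : 0 ≤ a) (hb : 0 ≤ b)
    (hf : ∀ s, 0 ≤ f s) (hg : Measurable g) (hh : Measurable h)
    (hle : ∀ s, f s ≤ a * g s + b * h s) :
    eLpNorm f 2 Q ≤ ENNReal.ofReal a * eLpNorm g 2 Q + ENNReal.ofReal b * eLpNorm h 2 Q := by
  calc eLpNorm f 2 Q ≤ eLpNorm (a • g + b • h) 2 Q :=
        eLpNorm_mono_real fun s => by
          rw [Real.norm_of_nonneg (hf s)]
          exact hle s
    _ ≤ eLpNorm (a • g) 2 Q + eLpNorm (b • h) 2 Q :=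
      eLpNorm_add_le (hg.const_smul a).aestronglyMeasurable
        (hh.const_smul b).aestronglyMeasurable one_le_two
    _ = _ := by
      rw [eLpNorm_const_smul, eLpNorm_const_smul, Real.enorm_of_nonneg ha, Real.enorm_of_nonneg hb]

end Probability

section Consensus

variable {H : Type*} [NormedAddCommGroup H] [InnerProductSpace ℝ H] {N : ℕ} {Ω S : Type*}

/-! ### The Lyapunov function of compressed gossip -/

/-- The `L²` norm of the disagreement of the clean states plus `χ` times the `L²` norm of the
tracking error. -/
noncomputable def lyapunov [MeasurableSpace S] (Q : Measure S) (χ : ℝ)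
    (p : S → (Fin N → H) × (Fin N → H)) : ENNReal :=
  eLpNorm (fun s => l2norm (deviation (p s).1)) 2 Q +
    ENNReal.ofReal χ * eLpNorm (fun s => l2norm ((p s).1 - (p s).2)) 2 Q

variable [MeasurableSpace S]

/-- Every component of a random state is strongly measurable. -/
def StateMeasurable (p : S → (Fin N → H) × (Fin N → H)) : Prop :=
  (∀ n, StronglyMeasurable fun s => (p s).1 n) ∧ ∀ n, StronglyMeasurable fun s => (p s).2 n

theorem StateMeasurable.stronglyMeasurable_average {p : S → (Fin N → H) × (Fin N → H)}
    (hp : StateMeasurable p) : StronglyMeasurable fun s => average (p s).1 :=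
  (Finset.stronglyMeasurable_fun_sum _ fun n _ => hp.1 n).const_smul _

theorem StateMeasurable.measurable_l2norm_deviation {p : S → (Fin N → H) × (Fin N → H)}
    (hp : StateMeasurable p) : Measurable fun s => l2norm (deviation (p s).1) :=
  measurable_l2norm fun n => (hp.1 n).sub hp.stronglyMeasurable_average

/-- Subtracting gradients of norm at most one raises the Lyapunov function by a bounded amount. -/
theorem lyapunov_sub_gradient_le {Q : Measure S} [IsProbabilityMeasure Q] {χ : ℝ} (hχ : 0 ≤ χ)
    {p : S → (Fin N → H) × (Fin N → H)} (hp : StateMeasurable p) {g : Fin N → S → H}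
    (hg : ∀ n s, ‖g n s‖ ≤ 1) :
    lyapunov Q χ (fun s => (fun n => (p s).1 n + -g n s, (p s).2)) ≤
      lyapunov Q χ p + ENNReal.ofReal ((2 + χ) * √N) := by
  have hconst : eLpNorm (fun _ : S => (1 : ℝ)) 2 Q = 1 := by
    rw [eLpNorm_const _ two_ne_zero (NeZero.ne Q)]
    simp
  have hgn : ∀ s, l2norm (fun n => -g n s) ≤ √N := fun s => by
    simpa using l2norm_le_of_norm_le zero_le_one fun n => by rw [norm_neg]; exact hg n s
  have hdn : ∀ s, l2norm (deviation fun n => -g n s) ≤ 2 * √N := fun s => by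
    refine l2norm_le_of_norm_le zero_le_two fun n => ?_
    have h1 : ‖average fun n => -g n s‖ ≤ 1 :=
      norm_average_le zero_le_one fun n => by rw [norm_neg]; exact hg n s
    have h2 : ‖-g n s‖ ≤ 1 := by rw [norm_neg]; exact hg n s
    exact (norm_sub_le _ _).trans (by linarith)
  have hD := eLpNorm_le_of_le_add (Q := Q) zero_le_one (by positivity : 0 ≤ 2 * √N)
    (fun s => l2norm_nonneg (deviation fun n => (p s).1 n + -g n s))
    hp.measurable_l2norm_deviation (measurable_const (a := (1 : ℝ))) fun s => by
      have : (fun n => (p s).1 n + -g n s) = (p s).1 + fun n => -g n s := rfl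
      rw [this, deviation_add]
      linarith [l2norm_add_le (deviation (p s).1) (deviation fun n => -g n s), hdn s]
  have hsub : Measurable fun s => l2norm ((p s).1 - (p s).2) :=
    measurable_l2norm fun n => (hp.1 n).sub (hp.2 n)
  have hE := eLpNorm_le_of_le_add (Q := Q) zero_le_one (by positivity : 0 ≤ √(N : ℝ))
    (fun s => l2norm_nonneg ((fun n => (p s).1 n + -g n s) - (p s).2))
    hsub (measurable_const (a := (1 : ℝ))) fun s => by
      have : (fun n => (p s).1 n + -g n s) - (p s).2 = ((p s).1 - (p s).2) + fun n => -g n s := by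
        funext n
        simp only [Pi.sub_apply, Pi.add_apply]
        abel
      rw [this]
      linarith [l2norm_add_le ((p s).1 - (p s).2) fun n => -g n s, hgn s]
  rw [hconst, ENNReal.ofReal_one, one_mul, mul_one] at hD hE
  have hB : ENNReal.ofReal ((2 + χ) * √N) =
      ENNReal.ofReal (2 * √N) + ENNReal.ofReal χ * ENNReal.ofReal √N := by
    rw [← ENNReal.ofReal_mul hχ, ← ENNReal.ofReal_add (by positivity) (by positivity), add_mul]
  unfold lyapunov
  rw [hB]
  calc _ ≤ (eLpNorm (fun s => l2norm (deviation (p s).1)) 2 Q + ENNReal.ofReal (2 * √N)) +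
        ENNReal.ofReal χ * (eLpNorm (fun s => l2norm ((p s).1 - (p s).2)) 2 Q +
          ENNReal.ofReal √N) := by
        gcongr
    _ = _ := by ring

variable [MeasurableSpace H] [BorelSpace H] [MeasurableSpace Ω]
  {P : Measure Ω} {Q : Measure S} {C : Ω → H → H} {α : ℝ} {W : Matrix (Fin N) (Fin N) ℝ} {γ : ℝ}

theorem StateMeasurable.gossipStep (hC : IsCompressor P C α) {ω : Fin N → S → Ω}
    (hω : ∀ n, Measurable (ω n)) {p : S → (Fin N → H) × (Fin N → H)} (hp : StateMeasurable p) :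
    StateMeasurable fun s => gossipStep C W γ (fun n => ω n s) (p s) := by
  have h2 : ∀ n, StronglyMeasurable fun s => (p s).2 n + C (ω n s) ((p s).1 n - (p s).2 n) :=
    fun n => (hp.2 n).add (hC.stronglyMeasurable_comp (hω n) ((hp.1 n).sub (hp.2 n)))
  refine ⟨fun n => (hp.1 n).add (StronglyMeasurable.const_smul ?_ γ), h2⟩
  exact Finset.stronglyMeasurable_fun_sum _ fun j _ => ((h2 j).sub (h2 n)).const_smul _

theorem StateMeasurable.gossip (hC : IsCompressor P C α) {ω : ℕ → Fin N → S → Ω} {m : ℕ}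
    (hω : ∀ k n, k < m → Measurable (ω k n)) {p : S → (Fin N → H) × (Fin N → H)}
    (hp : StateMeasurable p) {k : ℕ} (hk : k ≤ m) :
    StateMeasurable fun s => gossip C W γ (fun k n => ω k n s) (p s) k := by
  induction k with
  | zero => exact hp
  | succ k ih => exact (ih (by omega)).gossipStep hC fun n => hω k n (by omega)

/-- The step-size condition of the theorem, in the form used by the Lyapunov argument. -/
theorem le_stepBound_iff {μ : ℝ} (hμ : 0 < μ) :
    γ ≤ stepBound α μ ↔
      γ ≤ 1 ∧ γ * (2 * √α * (1 + 4 / μ) + μ / 2) ≤ 1 - √α := by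
  rw [stepBound, le_min_iff, le_div_iff₀ (by positivity)]

/-- One compressed gossip substep with fresh draws contracts the Lyapunov function. The weight
`χ = μ / 4` of the tracking error balances the two contributions. -/
theorem lyapunov_gossipStep_le [IsProbabilityMeasure P] [IsProbabilityMeasure Q]
    {G : SimpleGraph (Fin N)} (hW : IsGossipMatrix G W) {ρ : ℝ} (hρ : IsContractionFactor W ρ)
    (hC : IsCompressor P C α) (hγ : 0 < γ) (hγ' : γ ≤ stepBound α (1 - ρ)) {ω : Fin N → S → Ω}
    {p : S → (Fin N → H) × (Fin N → H)} (hp : StateMeasurable p)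
    (hω : ∀ n, MeasurePreserving (ω n) Q P)
    (hind : ∀ n, IndepFun (ω n) (fun s n => (p s).1 n - (p s).2 n) Q) :
    lyapunov Q ((1 - ρ) / 4) (fun s => gossipStep C W γ (fun n => ω n s) (p s)) ≤
      ENNReal.ofReal (1 - γ * (1 - ρ) / 2) * lyapunov Q ((1 - ρ) / 4) p := by
  have hμ : 0 < 1 - ρ := sub_pos.2 hρ.lt_one
  have hμ1 : 1 - ρ ≤ 1 := by linarith [hρ.nonneg]
  obtain ⟨hγ1, hγ2⟩ := (le_stepBound_iff hμ).1 hγ'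
  set μ := 1 - ρ with hμdef
  set χ := μ / 4 with hχ
  have hγμ : γ * μ ≤ 1 := mul_le_one₀ hγ1 hμ.le hμ1
  set p' := fun s => gossipStep C W γ (fun n => ω n s) (p s) with hp'
  have hp'm : StateMeasurable p' := hp.gossipStep hC fun n => (hω n).measurable
  have herr : ∀ s, (p' s).2 - (p s).1 = fun n =>
      C (ω n s) ((p s).1 n - (p s).2 n) - ((p s).1 n - (p s).2 n) := by
    intro s
    funext n
    simp only [hp', DecoEF.gossipStep, Pi.sub_apply]
    abel
  have hmerr : Measurable fun s => l2norm ((p' s).2 - (p s).1) :=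
    measurable_l2norm fun n => (hp'm.2 n).sub (hp.1 n)
  have hA : eLpNorm (fun s => l2norm ((p' s).2 - (p s).1)) 2 Q ≤
      ENNReal.ofReal √α * eLpNorm (fun s => l2norm ((p s).1 - (p s).2)) 2 Q := by
    simp only [herr]
    exact hC.eLpNorm_residual_le hω (fun n => (hp.1 n).sub (hp.2 n)) hind
  have hD := eLpNorm_le_of_le_add (Q := Q) (by linarith : 0 ≤ 1 - γ * μ)
    (by linarith : 0 ≤ 2 * γ) (fun s => l2norm_nonneg (deviation (p' s).1))
    hp.measurable_l2norm_deviation hmerr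
    fun s => hW.l2norm_deviation_gossipStep_le C γ _ (p s) hρ hγ.le hγ1
  have hE := eLpNorm_le_of_le_add (Q := Q) (by linarith : 0 ≤ 2 * γ)
    (by linarith : 0 ≤ 1 + 2 * γ) (fun s => l2norm_nonneg ((p' s).1 - (p' s).2))
    hp.measurable_l2norm_deviation hmerr
    fun s => hW.l2norm_gossipStep_fst_sub_snd_le C γ _ (p s) hγ.le
  unfold lyapunov
  set d := eLpNorm (fun s => l2norm (deviation (p s).1)) 2 Q
  set e := eLpNorm (fun s => l2norm ((p s).1 - (p s).2)) 2 Q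
  have hcoefD : ENNReal.ofReal (1 - γ * μ) + ENNReal.ofReal χ * ENNReal.ofReal (2 * γ) ≤
      ENNReal.ofReal (1 - γ * μ / 2) := by
    rw [← ENNReal.ofReal_mul (by positivity), ← ENNReal.ofReal_add (by linarith) (by positivity)]
    refine ENNReal.ofReal_le_ofReal (le_of_eq ?_)
    rw [hχ]; ring
  have hcoefE : (ENNReal.ofReal (2 * γ) + ENNReal.ofReal χ * ENNReal.ofReal (1 + 2 * γ)) *
      ENNReal.ofReal √α ≤ ENNReal.ofReal (1 - γ * μ / 2) * ENNReal.ofReal χ := by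
    rw [← ENNReal.ofReal_mul (by positivity), ← ENNReal.ofReal_add (by positivity) (by positivity),
      ← ENNReal.ofReal_mul (by positivity), ← ENNReal.ofReal_mul (by linarith)]
    refine ENNReal.ofReal_le_ofReal ?_
    -- Here the step-size condition enters.
    have : (2 * γ + χ * (1 + 2 * γ)) * √α = χ * (√α + γ * (2 * √α * (1 + 4 / μ))) := by
      rw [hχ]; field_simp; ring
    rw [this, mul_comm _ χ]
    exact mul_le_mul_of_nonneg_left (by linarith) (by positivity)
  calc eLpNorm (fun s => l2norm (deviation (p' s).1)) 2 Q +
        ENNReal.ofReal χ * eLpNorm (fun s => l2norm ((p' s).1 - (p' s).2)) 2 Q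
      ≤ (ENNReal.ofReal (1 - γ * μ) * d + ENNReal.ofReal (2 * γ) * (ENNReal.ofReal √α * e)) +
        ENNReal.ofReal χ * (ENNReal.ofReal (2 * γ) * d +
          ENNReal.ofReal (1 + 2 * γ) * (ENNReal.ofReal √α * e)) := by
        gcongr
        · exact hD.trans (by gcongr)
        · exact hE.trans (by gcongr)
    _ = (ENNReal.ofReal (1 - γ * μ) + ENNReal.ofReal χ * ENNReal.ofReal (2 * γ)) * d +
        ((ENNReal.ofReal (2 * γ) + ENNReal.ofReal χ * ENNReal.ofReal (1 + 2 * γ)) *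
          ENNReal.ofReal √α) * e := by ring
    _ ≤ ENNReal.ofReal (1 - γ * μ / 2) * d +
        (ENNReal.ofReal (1 - γ * μ / 2) * ENNReal.ofReal χ) * e := by gcongr
    _ = _ := by ring

theorem lyapunov_gossip_le [IsProbabilityMeasure P] [IsProbabilityMeasure Q]
    {G : SimpleGraph (Fin N)} (hW : IsGossipMatrix G W) {ρ : ℝ} (hρ : IsContractionFactor W ρ)
    (hC : IsCompressor P C α) (hγ : 0 < γ) (hγ' : γ ≤ stepBound α (1 - ρ))
    {ω : ℕ → Fin N → S → Ω} {p : S → (Fin N → H) × (Fin N → H)} (hp : StateMeasurable p) {m : ℕ}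
    (hω : ∀ k n, k < m → MeasurePreserving (ω k n) Q P)
    (hind : ∀ k n, k < m → IndepFun (ω k n) (fun s n =>
      (gossip C W γ (fun k n => ω k n s) (p s) k).1 n -
        (gossip C W γ (fun k n => ω k n s) (p s) k).2 n) Q) {k : ℕ} (hk : k ≤ m) :
    lyapunov Q ((1 - ρ) / 4) (fun s => gossip C W γ (fun k n => ω k n s) (p s) k) ≤
      ENNReal.ofReal (1 - γ * (1 - ρ) / 2) ^ k * lyapunov Q ((1 - ρ) / 4) p := by
  induction k with
  | zero => simp [gossip]
  | succ k ih =>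
    have hkm : k < m := hk
    refine (lyapunov_gossipStep_le hW hρ hC hγ hγ'
      (hp.gossip hC (fun k n h => (hω k n h).measurable) hkm.le)
      (fun n => hω k n hkm) (fun n => hind k n hkm)).trans ?_
    rw [pow_succ', mul_assoc]
    gcongr
    exact ih hkm.le

/-! ### Consensus along a run -/

namespace IsRun

variable {F : ℕ → ℝ → ℝ} {q : ℕ → ℕ} {ω : ℕ → ℕ → Fin N → S → Ω} {ℓ : ℕ → Fin N → S → H → ℝ}
  {g : ℕ → Fin N → S → H}

theorem norm_gradient_le (hrun : IsRun P Q F C W γ q ω ℓ g) (t : ℕ) (n : Fin N) (s : S) :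
    ‖g t n s‖ ≤ 1 :=
  (hrun.subgradient t n s).norm_le_one (hrun.loss_lipschitz t n s)

theorem stateMeasurable (hrun : IsRun P Q F C W γ q ω ℓ g) (hC : IsCompressor P C α) (t : ℕ) :
    StateMeasurable fun s => state C W γ q (fun t k n => ω t k n s) (fun t n => g t n s) t := by
  induction t with
  | zero => exact ⟨fun n => stronglyMeasurable_const, fun n => stronglyMeasurable_const⟩
  | succ t ih =>
    have h0 : StateMeasurable fun s =>
        ((fun n => (state C W γ q (fun t k n => ω t k n s) (fun t n => g t n s) t).1 n + -g t n s),
          (state C W γ q (fun t k n => ω t k n s) (fun t n => g t n s) t).2) :=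
      ⟨fun n => (ih.1 n).add (hrun.grad_measurable t n).neg, ih.2⟩
    exact h0.gossip hC (fun k n hk => (hrun.draw_law t k n hk).measurable) le_rfl

theorem lyapunov_state_succ_le [IsProbabilityMeasure P] [IsProbabilityMeasure Q]
    (hrun : IsRun P Q F C W γ q ω ℓ g) {G : SimpleGraph (Fin N)} (hW : IsGossipMatrix G W) {ρ : ℝ}
    (hρ : IsContractionFactor W ρ) (hC : IsCompressor P C α) (hγ : 0 < γ)
    (hγ' : γ ≤ stepBound α (1 - ρ)) (t : ℕ) :
    lyapunov Q ((1 - ρ) / 4)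
        (fun s => state C W γ q (fun t k n => ω t k n s) (fun t n => g t n s) (t + 1)) ≤
      ENNReal.ofReal (1 - γ * (1 - ρ) / 2) ^ q t * (lyapunov Q ((1 - ρ) / 4)
        (fun s => state C W γ q (fun t k n => ω t k n s) (fun t n => g t n s) t) +
          ENNReal.ofReal ((2 + (1 - ρ) / 4) * √N)) := by
  have hm := hrun.stateMeasurable hC t
  have h0 : StateMeasurable fun s =>
      ((fun n => (state C W γ q (fun t k n => ω t k n s) (fun t n => g t n s) t).1 n + -g t n s),
        (state C W γ q (fun t k n => ω t k n s) (fun t n => g t n s) t).2) :=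
    ⟨fun n => (hm.1 n).add (hrun.grad_measurable t n).neg, hm.2⟩
  have hχ : 0 ≤ (1 - ρ) / 4 := by linarith [hρ.lt_one]
  refine (lyapunov_gossip_le hW hρ hC hγ hγ' h0 (fun k n hk => hrun.draw_law t k n hk)
    (fun k n hk => hrun.draw_fresh t k n hk) le_rfl).trans ?_
  gcongr
  exact lyapunov_sub_gradient_le hχ hm (hrun.norm_gradient_le t)

end IsRun

end Consensus

/-! ### Network regret -/

theorem networkRegret_eq {X : Type*} {N : ℕ} (hN : 0 < N) (ℓ : ℕ → Fin N → X → ℝ)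
    (x : ℕ → Fin N → X) (T : ℕ) (u : X) :
    networkRegret ℓ x T u = ∑ t ∈ Finset.range T, 1 / (N : ℝ) * ∑ n, 1 / (N : ℝ) *
      ∑ j, (ℓ t j (x t n) - ℓ t j u) := by
  have hN' : (N : ℝ) ≠ 0 := by positivity
  rw [networkRegret, ← Finset.sum_sub_distrib]
  refine Finset.sum_congr rfl fun t _ => ?_
  simp only [networkLoss, Finset.sum_sub_distrib, mul_sub, Finset.sum_const, Finset.card_univ,
    Fintype.card_fin, nsmul_eq_mul]
  field_simp

section Regret

variable {H : Type*} [NormedAddCommGroup H] [InnerProductSpace ℝ H] {N : ℕ}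

/-- Linearization: the network regret is at most the linear regret of any reference point `y t`,
plus three times the mean distance of the predictions from `y t`. -/
theorem networkRegret_le (hN : 0 < N) {ℓ : ℕ → Fin N → H → ℝ} {x g : ℕ → Fin N → H}
    (hℓ : ∀ t n, LipschitzWith 1 (ℓ t n)) (hg : ∀ t n, IsSubgradient (ℓ t n) (x t n) (g t n))
    (y : ℕ → H) (T : ℕ) (u : H) :
    networkRegret ℓ x T u ≤ ∑ t ∈ Finset.range T, inner ℝ (average (g t)) (y t - u) +
      3 * ∑ t ∈ Finset.range T, 1 / (N : ℝ) * ∑ n, ‖x t n - y t‖ := by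
  have hN' : (N : ℝ) ≠ 0 := by positivity
  rw [networkRegret_eq hN, Finset.mul_sum, ← Finset.sum_add_distrib]
  refine Finset.sum_le_sum fun t _ => ?_
  have hterm : ∀ n j, ℓ t j (x t n) - ℓ t j u ≤
      inner ℝ (g t j) (y t - u) + ‖x t n - y t‖ + 2 * ‖x t j - y t‖ := by
    intro n j
    have h1 := (le_abs_self _).trans ((hℓ t j).dist_le_mul (x t n) (x t j))
    rw [NNReal.coe_one, one_mul, dist_eq_norm] at h1
    have h2 := hg t j u
    have h3 : inner ℝ (g t j) (u - x t j) =
        -inner ℝ (g t j) (y t - u) - inner ℝ (g t j) (x t j - y t) := by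
      rw [← inner_neg_right, ← inner_sub_right]
      congr 1
      abel
    have h4 : inner ℝ (g t j) (x t j - y t) ≤ ‖x t j - y t‖ :=
      (real_inner_le_norm _ _).trans
        (mul_le_of_le_one_left (norm_nonneg _) ((hg t j).norm_le_one (hℓ t j)))
    have h5 : ‖x t n - x t j‖ ≤ ‖x t n - y t‖ + ‖x t j - y t‖ := by
      rw [norm_sub_rev (x t j)]
      exact norm_sub_le_norm_sub_add_norm_sub _ _ _
    linarith
  calc 1 / (N : ℝ) * ∑ n, 1 / (N : ℝ) * ∑ j, (ℓ t j (x t n) - ℓ t j u)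
      ≤ 1 / (N : ℝ) * ∑ n, 1 / (N : ℝ) *
        ∑ j, (inner ℝ (g t j) (y t - u) + ‖x t n - y t‖ + 2 * ‖x t j - y t‖) := by
        gcongr with n _ j _
        exact hterm n j
    _ = _ := by
      rw [average, real_inner_smul_left, sum_inner]
      simp only [Finset.sum_add_distrib, mul_add, Finset.sum_const, Finset.card_univ,
        Fintype.card_fin, nsmul_eq_mul, ← Finset.mul_sum]
      field_simp
      ring

/-- The mean distance of the predictions from the centralized prediction is controlled by the
disagreement of the clean states. -/
theorem mean_norm_prediction_sub_le {Ω : Type*} {C : Ω → H → H}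
    {W : Matrix (Fin N) (Fin N) ℝ} {γ : ℝ} {F : ℕ → ℝ → ℝ} {q : ℕ → ℕ} {ε A r : ℝ}
    (hF : IsBettingPotential F ε A r) (hN : 0 < N)
    {G : SimpleGraph (Fin N)} (hW : IsGossipMatrix G W) (o : ℕ → ℕ → Fin N → Ω)
    {g : ℕ → Fin N → H} (hg : ∀ t n, ‖g t n‖ ≤ 1) (t : ℕ) :
    1 / (N : ℝ) * ∑ n, ‖prediction F C W γ q o g t n -
        bet F (t + 1) (-∑ i ∈ Finset.range t, average (g i))‖ ≤
      A * r ^ t * l2norm (deviation (state C W γ q o g t).1) := by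
  have hN' : (0 : ℝ) < N := by exact_mod_cast hN
  have hnorm : ‖-∑ i ∈ Finset.range t, average (g i)‖ ≤ t :=
    norm_neg_sum_le (fun i => norm_average_le zero_le_one (hg i)) t
  rw [one_div, inv_mul_le_iff₀ hN']
  calc ∑ n, ‖prediction F C W γ q o g t n -
        bet F (t + 1) (-∑ i ∈ Finset.range t, average (g i))‖
      ≤ ∑ _n : Fin N, A * r ^ t * l2norm (deviation (state C W γ q o g t).1) := by
        refine Finset.sum_le_sum fun n _ => ?_
        have h := hF.norm_bet_clip_sub_le t ((state C W γ q o g t).1 n)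
          (-∑ i ∈ Finset.range t, average (g i))
        rw [clip_of_norm_le hnorm] at h
        refine h.trans (mul_le_mul_of_nonneg_left ?_ (hF.growth_nonneg t))
        rw [← hW.average_state C γ q o g t]
        exact norm_le_l2norm (deviation (state C W γ q o g t).1) n
    _ = _ := by simp

end Regret

/-! ### Expectations along a run -/

theorem integrable_and_integral_le_of_eLpNorm_two_le {S : Type*}
    [MeasurableSpace S] {Q : Measure S} [IsProbabilityMeasure Q] {f : S → ℝ}
    (hf : Measurable f) (h0 : ∀ s, 0 ≤ f s) {c : ℝ} (hc : 0 ≤ c)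
    (h : eLpNorm f 2 Q ≤ ENNReal.ofReal c) : Integrable f Q ∧ ∫ s, f s ∂Q ≤ c := by
  have h1 : eLpNorm f 1 Q ≤ ENNReal.ofReal c :=
    (eLpNorm_le_eLpNorm_of_exponent_le one_le_two hf.aestronglyMeasurable).trans h
  refine ⟨memLp_one_iff_integrable.1
    ⟨hf.aestronglyMeasurable, h1.trans_lt ENNReal.ofReal_lt_top⟩, ?_⟩
  rw [integral_eq_lintegral_of_nonneg_ae (Filter.Eventually.of_forall h0) hf.aestronglyMeasurable]
  refine ENNReal.toReal_le_of_le_ofReal hc ((le_of_eq ?_).trans h1)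
  rw [eLpNorm_one_eq_lintegral_enorm]
  exact lintegral_congr fun s => (Real.enorm_of_nonneg (h0 s)).symm

/-- A random continuous function, evaluated at a random point of a possibly nonseparable space. -/
theorem measurable_apply_of_continuous {S E : Type*} [MeasurableSpace S] [TopologicalSpace E]
    {f : S → E → ℝ} (hc : ∀ s, Continuous (f s))
    (hm : ∀ x, Measurable fun s => f s x) {x : S → E} (hx : StronglyMeasurable x) :
    Measurable fun s => f s (x s) :=
  measurable_of_tendsto_metrizable
    (fun n => SimpleFunc.measurable_bind (hx.approx n) (fun y s => f s y) hm)
    (tendsto_pi_nhds.2 fun s => ((hc s).tendsto _).comp (hx.tendsto_approx s))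

section Expectation

variable {H : Type*} [NormedAddCommGroup H] [InnerProductSpace ℝ H] [MeasurableSpace H]
  [BorelSpace H] {N : ℕ} {Ω S : Type*} [MeasurableSpace S] [MeasurableSpace Ω]
  {P : Measure Ω} {Q : Measure S} {C : Ω → H → H} {α : ℝ} {W : Matrix (Fin N) (Fin N) ℝ} {γ : ℝ}
  {F : ℕ → ℝ → ℝ} {q : ℕ → ℕ} {ω : ℕ → ℕ → Fin N → S → Ω} {ℓ : ℕ → Fin N → S → H → ℝ}
  {g : ℕ → Fin N → S → H} {ε A r : ℝ}

namespace IsRun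

theorem lyapunov_state_le [IsProbabilityMeasure P] [IsProbabilityMeasure Q]
    (hrun : IsRun P Q F C W γ q ω ℓ g) {G : SimpleGraph (Fin N)} (hW : IsGossipMatrix G W) {ρ : ℝ}
    (hρ : IsContractionFactor W ρ) (hC : IsCompressor P C α) (hγ : 0 < γ)
    (hγ' : γ ≤ stepBound α (1 - ρ)) {b : ℝ} (hb : 0 ≤ b) (hb' : b ≤ 1 / 2)
    (hq : ∀ t, (1 - γ * (1 - ρ) / 2) ^ q t ≤ b ^ t) (t : ℕ) :
    lyapunov Q ((1 - ρ) / 4)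
        (fun s => state C W γ q (fun t k n => ω t k n s) (fun t n => g t n s) (t + 1)) ≤
      ENNReal.ofReal (b ^ t * (2 * ((2 + (1 - ρ) / 4) * √N))) := by
  have hμ : 0 < 1 - ρ := sub_pos.2 hρ.lt_one
  have hη : 0 ≤ 1 - γ * (1 - ρ) / 2 := by
    have := mul_le_one₀ ((le_stepBound_iff hμ).1 hγ').1 hμ.le (by linarith [hρ.nonneg])
    linarith
  set B := (2 + (1 - ρ) / 4) * √N with hB
  have hB0 : 0 ≤ B := by positivity
  set V : ℕ → ENNReal := fun t => lyapunov Q ((1 - ρ) / 4)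
    (fun s => state C W γ q (fun t k n => ω t k n s) (fun t n => g t n s) t) with hV
  have hstep : ∀ t, V (t + 1) ≤ ENNReal.ofReal (b ^ t) * (V t + ENNReal.ofReal B) := fun t =>
    (hrun.lyapunov_state_succ_le hW hρ hC hγ hγ' t).trans (by
      rw [← ENNReal.ofReal_pow hη]
      gcongr
      exact hq t)
  have hV0 : V 0 = 0 := by
    have hd : l2norm (deviation (0 : Fin N → H)) = 0 := by
      have : deviation (0 : Fin N → H) = 0 := by
        ext n
        simp [deviation, average]
      rw [this]
      simp [l2norm]
    have hz : l2norm (0 : Fin N → H) = 0 := by simp [l2norm]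
    simp only [hV, lyapunov, state, sub_self, hd, hz]
    simp
  -- The first round has no gossip substep, so `V 1` is only bounded by `B`; later rounds halve.
  have hall : ∀ t, V t ≤ ENNReal.ofReal B := by
    intro t
    induction t with
    | zero => simp [hV0]
    | succ t ih =>
      refine (hstep t).trans ?_
      rcases t.eq_zero_or_pos with rfl | ht
      · simp [hV0]
      · calc ENNReal.ofReal (b ^ t) * (V t + ENNReal.ofReal B)
            ≤ ENNReal.ofReal (1 / 2) * (ENNReal.ofReal B + ENNReal.ofReal B) := by
              gcongr
              exact (pow_le_of_le_one hb (by linarith) ht.ne').trans hb'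
          _ = ENNReal.ofReal B := by
            rw [← ENNReal.ofReal_add hB0 hB0, ← ENNReal.ofReal_mul (by norm_num)]
            congr 1
            ring
  calc V (t + 1) ≤ ENNReal.ofReal (b ^ t) * (V t + ENNReal.ofReal B) := hstep t
    _ ≤ ENNReal.ofReal (b ^ t) * (ENNReal.ofReal B + ENNReal.ofReal B) := by gcongr; exact hall t
    _ = _ := by
      rw [← ENNReal.ofReal_add hB0 hB0, ← ENNReal.ofReal_mul (by positivity), two_mul]

theorem stronglyMeasurable_prediction (hrun : IsRun P Q F C W γ q ω ℓ g)
    (hF : IsBettingPotential F ε A r) (hC : IsCompressor P C α) (t : ℕ) (n : Fin N) :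
    StronglyMeasurable fun s =>
      prediction F C W γ q (fun t k n => ω t k n s) (fun t n => g t n s) t n :=
  (hF.continuous_bet_clip t).comp_stronglyMeasurable ((hrun.stateMeasurable hC t).1 n)

theorem integrable_networkRegret [IsProbabilityMeasure Q] (hrun : IsRun P Q F C W γ q ω ℓ g)
    (hF : IsBettingPotential F ε A r) (hC : IsCompressor P C α) (hN : 0 < N) (T : ℕ) (u : H) :
    Integrable (fun s => networkRegret (fun t n => ℓ t n s)
      (prediction F C W γ q (fun t k n => ω t k n s) (fun t n => g t n s)) T u) Q := by
  simp only [networkRegret_eq hN]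
  refine integrable_finsetSum _ fun t _ => Integrable.const_mul (integrable_finsetSum _ fun n _ =>
    Integrable.const_mul (integrable_finsetSum _ fun j _ => ?_) _) _
  refine Integrable.of_bound (C := A * r ^ t + ‖u‖) ?_ (Filter.Eventually.of_forall fun s => ?_)
  · exact ((measurable_apply_of_continuous (fun s => (hrun.loss_lipschitz t j s).continuous)
      (hrun.loss_measurable t j) (hrun.stronglyMeasurable_prediction hF hC t n)).sub
      (hrun.loss_measurable t j u)).aestronglyMeasurable
  · have h := (hrun.loss_lipschitz t j s).dist_le_mul
      (prediction F C W γ q (fun t k n => ω t k n s) (fun t n => g t n s) t n) u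
    rw [NNReal.coe_one, one_mul, dist_eq_norm, dist_eq_norm] at h
    exact h.trans ((norm_sub_le _ _).trans
      (add_le_add (hF.norm_bet_le (norm_clip_le t _)) le_rfl))

theorem integral_networkRegret_le [IsProbabilityMeasure P] [IsProbabilityMeasure Q]
    (hrun : IsRun P Q F C W γ q ω ℓ g) (hF : IsBettingPotential F ε A r) (hA : 0 ≤ A)
    (hr : 0 ≤ r) (hN : 0 < N) {G : SimpleGraph (Fin N)} (hW : IsGossipMatrix G W) {ρ : ℝ}
    (hρ : IsContractionFactor W ρ) (hC : IsCompressor P C α) (hγ : 0 < γ)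
    (hγ' : γ ≤ stepBound α (1 - ρ)) {b : ℝ} (hb : 0 ≤ b) (hb' : b ≤ 1 / 2) (hrb : r * b ≤ 1 / 2)
    (hq : ∀ t, (1 - γ * (1 - ρ) / 2) ^ q t ≤ b ^ t) (T : ℕ) (u : H) :
    ∫ s, networkRegret (fun t n => ℓ t n s)
        (prediction F C W γ q (fun t k n => ω t k n s) (fun t n => g t n s)) T u ∂Q ≤
      conjugate F T ‖u‖ + ε + 3 * (4 * A * r * ((2 + (1 - ρ) / 4) * √N)) := by
  have hμ : 0 < 1 - ρ := sub_pos.2 hρ.lt_one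
  set B := (2 + (1 - ρ) / 4) * √N with hB
  have hB0 : 0 ≤ B := by positivity
  set D : ℕ → S → ℝ := fun t s => l2norm (deviation
    (state C W γ q (fun t k n => ω t k n s) (fun t n => g t n s) t).1) with hD
  have hDm : ∀ t, Measurable (D t) := fun t =>
    (hrun.stateMeasurable hC t).measurable_l2norm_deviation
  have hD0 : ∀ s, D 0 s = 0 := by
    intro s
    have : deviation (0 : Fin N → H) = 0 := by
      ext n
      simp [deviation, average]
    simp only [hD, state, this]
    simp [l2norm]
  have hDs : ∀ t, Integrable (D (t + 1)) Q ∧ ∫ s, D (t + 1) s ∂Q ≤ b ^ t * (2 * B) := fun t =>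
    integrable_and_integral_le_of_eLpNorm_two_le (hDm _) (fun s => l2norm_nonneg _)
      (by positivity)
      (le_self_add.trans (hrun.lyapunov_state_le hW hρ hC hγ hγ' hb hb' hq t))
  have hDi : ∀ t, Integrable (D t) Q := by
    rintro (_ | t)
    · exact (integrable_zero S ℝ Q).congr (Filter.Eventually.of_forall fun s => (hD0 s).symm)
    · exact (hDs t).1
  have hpt : ∀ s, networkRegret (fun t n => ℓ t n s)
      (prediction F C W γ q (fun t k n => ω t k n s) (fun t n => g t n s)) T u ≤
      conjugate F T ‖u‖ + ε + 3 * ∑ t ∈ Finset.range T, A * r ^ t * D t s := by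
    intro s
    refine (networkRegret_le hN (fun t n => hrun.loss_lipschitz t n s)
      (fun t n => hrun.subgradient t n s)
      (fun t => bet F (t + 1) (-∑ i ∈ Finset.range t, average fun n => g i n s)) T u).trans ?_
    refine add_le_add (hF.sum_inner_bet_sub_le
      (fun t => norm_average_le zero_le_one fun n => hrun.norm_gradient_le t n s) T u) ?_
    exact mul_le_mul_of_nonneg_left (Finset.sum_le_sum fun t _ =>
      mean_norm_prediction_sub_le hF hN hW _ (fun t n => hrun.norm_gradient_le t n s) t)
      zero_le_three
  have hsumi : Integrable (fun s => ∑ t ∈ Finset.range T, A * r ^ t * D t s) Q :=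
    integrable_finsetSum _ fun t _ => (hDi t).const_mul _
  -- The growth `r ^ t` of the Lipschitz constants is beaten by the consensus rate `b ^ t`.
  have hsum : ∑ t ∈ Finset.range T, A * r ^ t * ∫ s, D t s ∂Q ≤ 4 * A * r * B := by
    have hterm : ∀ t, A * r ^ (t + 1) * ∫ s, D (t + 1) s ∂Q ≤ (2 * A * r * B) * (1 / 2) ^ t := by
      intro t
      calc A * r ^ (t + 1) * ∫ s, D (t + 1) s ∂Q ≤ A * r ^ (t + 1) * (b ^ t * (2 * B)) := by
            gcongr
            exact (hDs t).2
        _ = (2 * A * r * B) * (r * b) ^ t := by ring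
        _ ≤ _ := by gcongr
    have hnn : ∀ t, 0 ≤ A * r ^ t * ∫ s, D t s ∂Q := fun t =>
      mul_nonneg (by positivity) (integral_nonneg fun s => l2norm_nonneg _)
    calc ∑ t ∈ Finset.range T, A * r ^ t * ∫ s, D t s ∂Q
        ≤ ∑ t ∈ Finset.range (T + 1), A * r ^ t * ∫ s, D t s ∂Q :=
          Finset.sum_le_sum_of_subset_of_nonneg (Finset.range_mono T.le_succ) fun t _ _ => hnn t
      _ = ∑ t ∈ Finset.range T, A * r ^ (t + 1) * ∫ s, D (t + 1) s ∂Q := by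
        rw [Finset.sum_range_succ']
        simp [hD0]
      _ ≤ ∑ t ∈ Finset.range T, (2 * A * r * B) * (1 / 2) ^ t :=
        Finset.sum_le_sum fun t _ => hterm t
      _ = (2 * A * r * B) * ∑ t ∈ Finset.range T, (1 / 2) ^ t := by rw [Finset.mul_sum]
      _ ≤ (2 * A * r * B) * 2 := by
        gcongr
        exact sum_geometric_two_le T
      _ = 4 * A * r * B := by ring
  calc _ ≤ ∫ s, (conjugate F T ‖u‖ + ε + 3 * ∑ t ∈ Finset.range T, A * r ^ t * D t s) ∂Q :=
        integral_mono (hrun.integrable_networkRegret hF hC hN T u)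
          ((integrable_const _).add (hsumi.const_mul 3)) hpt
    _ = conjugate F T ‖u‖ + ε + 3 * ∑ t ∈ Finset.range T, A * r ^ t * ∫ s, D t s ∂Q := by
      rw [integral_add (integrable_const _) (hsumi.const_mul 3), integral_const,
        integral_const_mul, integral_finsetSum _ fun t _ => (hDi t).const_mul _]
      simp [integral_const_mul]
    _ ≤ _ := by gcongr

end IsRun

end Expectation

/-! ### The gossip schedule -/

theorem pow_ceil_le {η κ c : ℝ} (h0 : 0 < η) (h1 : η < 1) (hc : -κ / Real.log η ≤ c) (t : ℕ) :
    η ^ ⌈c * (t : ℝ)⌉₊ ≤ Real.exp (-κ) ^ t := by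
  have hlog := Real.log_neg h0 h1
  rw [div_le_iff_of_neg hlog] at hc
  rw [← Real.exp_log (pow_pos h0 _), Real.log_pow, ← Real.exp_nat_mul, Real.exp_le_exp]
  calc (⌈c * (t : ℝ)⌉₊ : ℝ) * Real.log η ≤ c * t * Real.log η :=
        mul_le_mul_of_nonpos_right (Nat.le_ceil _) hlog.le
    _ = t * (c * Real.log η) := by ring
    _ ≤ t * -κ := by gcongr

/-- For both potentials the slope bound of the schedule gives a decay rate `exp (-κ)` per round that
beats the growth rate `r` of the Lipschitz constants. -/
theorem exists_growth_decay (kind : Kind) {ε : ℝ} (hε : 0 < ε) :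
    ∃ A r κ : ℝ, IsBettingPotential (potential kind ε) ε A r ∧ 0 ≤ A ∧ 0 ≤ r ∧
      Real.exp (-κ) ≤ 1 / 2 ∧ r * Real.exp (-κ) ≤ 1 / 2 ∧ 4 * A * r ≤ schedConst kind ε / 2 ∧
      ∀ η, slopeBound kind η = -κ / Real.log η := by
  cases kind with
  | KT =>
    have he : Real.exp (-(2 * Real.log 2)) = 1 / 4 := by
      rw [Real.exp_neg, two_mul, Real.exp_add, Real.exp_log two_pos]
      norm_num
    refine ⟨4 * ε, 2, 2 * Real.log 2, isBettingPotential_potentialKT hε, by positivity, by norm_num,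
      by rw [he]; norm_num, by rw [he]; norm_num, ?_, fun η => rfl⟩
    have hl : 2 ≤ 2 / Real.log 2 := by
      rw [le_div_iff₀ (Real.log_pos one_lt_two)]
      linarith [Real.log_two_lt_d9]
    rw [schedConst]
    nlinarith
  | SE =>
    have h2 : 2 ≤ Real.exp 1 := by linarith [Real.exp_one_gt_d9]
    have hinv : Real.exp (-1) ≤ 1 / 2 := by
      rw [Real.exp_neg, one_div]
      exact inv_anti₀ two_pos h2
    refine ⟨2 * ε, Real.exp (1 / 2), 3 / 2, isBettingPotential_potentialSE hε, by positivity,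
      by positivity, (Real.exp_le_exp.2 (by norm_num)).trans hinv, ?_, ?_, fun η => ?_⟩
    · rw [← Real.exp_add]
      norm_num at hinv ⊢
      exact hinv
    · rw [schedConst, show (3 / 2 : ℝ) = 1 + 1 / 2 by norm_num, Real.exp_add]
      have hp := Real.exp_pos (1 / 2)
      have h3 : 2 * Real.exp (1 / 2) ≤ Real.exp 1 * Real.exp (1 / 2) := by gcongr
      have h4 := mul_le_mul_of_nonneg_right h3 hε.le
      nlinarith
    · rw [slopeBound, neg_div, neg_div, ← div_div]

end DecoEF

theorem mainTheorem1 {N : ℕ} (G : SimpleGraph (Fin N)) (hG : G.Connected)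
    (W : Matrix (Fin N) (Fin N) ℝ) (hW : DecoEF.IsGossipMatrix G W) :
    (∃ ρ : ℝ, DecoEF.IsContractionFactor W ρ) ∧
    ∀ ρ : ℝ, DecoEF.IsContractionFactor W ρ →
    ∀ {H : Type*} [NormedAddCommGroup H] [InnerProductSpace ℝ H] [CompleteSpace H]
      [MeasurableSpace H] [BorelSpace H]
      {Ω : Type*} [MeasurableSpace Ω] (P : Measure Ω) [IsProbabilityMeasure P]
      {S : Type*} [MeasurableSpace S] (Q : Measure S) [IsProbabilityMeasure Q]
      (C : Ω → H → H) (α : ℝ), DecoEF.IsCompressor P C α →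
    ∀ (kind : DecoEF.Kind) (ε γ c : ℝ), 0 < ε →
      0 < γ → γ ≤ DecoEF.stepBound α (1 - ρ) →
      DecoEF.slopeBound kind (1 - γ * (1 - ρ) / 2) ≤ c →
    ∀ (ω : ℕ → ℕ → Fin N → S → Ω) (ℓ : ℕ → Fin N → S → H → ℝ) (g : ℕ → Fin N → S → H),
      DecoEF.IsRun P Q (DecoEF.potential kind ε) C W γ (fun t => ⌈c * (t : ℝ)⌉₊) ω ℓ g →
    ∀ (u : H) (T : ℕ), 0 < T →
      Integrable (fun s => DecoEF.networkRegret (fun t n => ℓ t n s)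
        (DecoEF.prediction (DecoEF.potential kind ε) C W γ (fun t => ⌈c * (t : ℝ)⌉₊)
          (fun t k n => ω t k n s) (fun t n => g t n s)) T u) Q ∧
      ∫ s, DecoEF.networkRegret (fun t n => ℓ t n s)
        (DecoEF.prediction (DecoEF.potential kind ε) C W γ (fun t => ⌈c * (t : ℝ)⌉₊)
          (fun t k n => ω t k n s) (fun t n => g t n s)) T u ∂Q
        ≤ DecoEF.conjugate (DecoEF.potential kind ε) T ‖u‖ + ε
          + DecoEF.regConst kind ε (1 - ρ) N * Real.sqrt T := by
  refine ⟨hW.exists_isContractionFactor hG, ?_⟩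
  intro ρ hρ H _ _ _ _ _ Ω _ P _ S _ Q _ C α hC kind ε γ c hε hγ hγ' hc ω ℓ g hrun u T hT
  have hN : 0 < N := Fin.pos_iff_nonempty.2 hG.nonempty
  obtain ⟨A, r, κ, hF, hA, hr, hκ, hrκ, hconst, hslope⟩ := DecoEF.exists_growth_decay kind hε
  refine ⟨hrun.integrable_networkRegret hF hC hN T u, ?_⟩
  have hμ : 0 < 1 - ρ := sub_pos.2 hρ.lt_one
  have hγμ : γ * (1 - ρ) ≤ 1 :=
    mul_le_one₀ ((DecoEF.le_stepBound_iff hμ).1 hγ').1 hμ.le (by linarith [hρ.nonneg])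
  have hγμ0 : 0 < γ * (1 - ρ) := mul_pos hγ hμ
  rw [hslope] at hc
  refine (hrun.integral_networkRegret_le hF hA hr hN hW hρ hC hγ hγ' (Real.exp_pos _).le hκ hrκ
    (DecoEF.pow_ceil_le (by linarith) (by linarith) hc) T u).trans ?_
  have hB : 0 ≤ (2 + (1 - ρ) / 4) * √(N : ℝ) := by positivity
  have hnet : 4 * A * r * ((2 + (1 - ρ) / 4) * √N) ≤ DecoEF.netConst kind ε (1 - ρ) N := by
    rw [DecoEF.netConst]
    nlinarith [mul_le_mul_of_nonneg_right hconst hB]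
  have hnet0 : 0 ≤ DecoEF.netConst kind ε (1 - ρ) N := le_trans (by positivity) hnet
  have hT1 : 1 ≤ √(T : ℝ) := by
    rw [Real.one_le_sqrt]
    exact_mod_cast hT
  rw [DecoEF.regConst]
  nlinarith
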